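/- Let $G$ be a compact Lie group with a bi-invariant metric and $K\subset G$ a closed subgroup, with orthogonal decomposition $\mathfrak g=\mathfrak k\oplus\mathfrak p_1\oplus\dots\oplus\mathfrak p_r$, $r\ge 2$, where the $\mathfrak p_i$ are irreducible, pairwise inequivalent real $\mathrm{Ad}_K$-modules. Put $d_i=\dim\mathfrak p_i$, $d=(d_1,\dots,d_r)$, $n=\sum_i d_i$ and $$J(p,p')=\frac1{n-1}\Big(\sum_i p_i\Big)\Big(\sum_i p_i'\Big)-\sum_i\frac{p_ip_i'}{d_i}.$$ A vector $\bar c\in\mathbb R^r$ is *null* if $J(\bar c,\bar c)=0$. The scalar curvature of the invariant metric with eigenvalue $x_i=e^{q_i}$ on $\mathfrak p_i$ is $$\mathsf S=\frac12\sum_i\frac{a_i}{x_i}-\frac14\sum_{i,j,k}[ijk]\frac{x_k}{x_ix_j}=\sum_{w\in\mathcal W}A_w e^{w\cdot q},\qquad A_w\ne0,$$ where $a_i=-\sum_\alpha B(e_\alpha,e_\alpha)$ for an orthonormal basis $(e_\alpha)$ of $\mathfrak p_i$ ($B$ the Killing form of $\mathfrak g$) and $[ijk]=\sum\langle[e_\alpha,e_\beta],e_\gamma\rangle^2$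 over orthonormal bases of $\mathfrak p_i,\mathfrak p_j,\mathfrak p_k$. Assume $\dim\mathrm{conv}(\mathcal W)=r-1$. Let $u=\sum_{\bar c\in\mathcal C}F_{\bar c}\,e^{\bar c\cdot q}$, with $\mathcal C\subset\mathbb R^r$ finite and all $F_{\bar c}\neq0$ real, be a superpotential of the cohomogeneity one Ricci-flat equations, i.e. $\mathsf H(q,du_q)=0$ for all $q\in\mathbb R^r$, where $\mathsf H(q,p)=v^{-1}J(p,p)-v\,\mathsf S$ and $v=e^{\frac12 d\cdot q}$. Write $\bar w=\frac12(d+w)$ and $P=\mathrm{conv}(\frac12(d+\mathcal W))$. Let $\bar c\in\mathcal C$ be null, take an affine hyperplane strictly separating $\bar c$ from $P$, and let $\Delta^{\bar c}$ be the image of $P$ under perspective projection from $\bar c$ onto this hyperplane. Suppose $\Delta^{\bar c}$ has a type (2) vertex: a vertex $\xi$ with $J(\bar c,\xi)\ne0$ such that the line through $\bar c$ and $\xi$ meets $P$ in an edge $\bar V\bar W$ ($\bar V\neq\bar W$, $\bar V$ nearer to $\bar c$). Suppose also that the midpoint of $\bar V\bar W$ lies in $\frac12(d+\mathcal W)$.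 Then: 1. $\bar W\notin\mathcal C$, and there is an element of $\mathcal C$ lying beyond $\bar W$, i.e. a point $\bar e\in\mathcal C$ such that $\bar W$ lies strictly between $\bar V$ and $\bar e$. 2. $\bar c=\lambda\bar V+(1-\lambda)\bar W$ with $1<\lambda\le\frac32$. 3. Let $\epsilon_1,\dots,\epsilon_r$ be the standard basis of $\mathbb R^r$. For no $i\ne j$ is $\{V,W\}=\{-\epsilon_i,\ \epsilon_i-2\epsilon_j\}$ (in either order). If $V=\epsilon_j-2\epsilon_i$ and $W=\epsilon_j-2\epsilon_k$ with $i,j,k$ distinct, then $d_i=d_k$. -/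

import Mathlib

open scoped Manifold ContDiff

noncomputable section

namespace Superpotential

/-! ## Scalar curvature data and the Hamiltonian on the space of diagonal metrics -/

/-- The numerical data entering the scalar curvature function of a homogeneous space with
multiplicity free isotropy representation: the dimensions `d i` of the summands, the
coefficients `a i` and the structure constants `[ijk]`. No relation between them is imposed. -/
structure ScalarCurvatureData (r : ℕ) where
  d : Fin r → ℕ
  a : Fin r → ℝ
  bracket : Fin r → Fin r → Fin r → ℝ

namespace ScalarCurvatureData

variable {r : ℕ} (S : ScalarCurvatureData r)

/-- The dimension vector `d = (d₁, …, d_r)`. -/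
def dVec : Fin r → ℝ := fun i => (S.d i : ℝ)

/-- The total dimension `n = d₁ + ⋯ + d_r`, as a real number. -/
def n : ℝ := ∑ i, (S.d i : ℝ)

/-- The (polarised) quadratic form
`J(p, p') = (1/(n-1)) (∑ pᵢ) (∑ p'ᵢ) - ∑ pᵢ p'ᵢ / dᵢ`. -/
def J (p p' : Fin r → ℝ) : ℝ :=
  1 / (S.n - 1) * ((∑ i, p i) * (∑ i, p' i)) - ∑ i, p i * p' i / (S.d i : ℝ)

/-- The scalar curvature of the metric with eigenvalue `x i` on the `i`-th summand:
`½ ∑ aᵢ / xᵢ - ¼ ∑ [ijk] x_k / (xᵢ x_j)`, the second sum being over all ordered triples. -/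
def scalarCurvature (x : Fin r → ℝ) : ℝ :=
  1 / 2 * ∑ i, S.a i / x i
    - 1 / 4 * ∑ i, ∑ j, ∑ k, S.bracket i j k * (x k / (x i * x j))

/-- The relative volume `∏ xᵢ ^ (dᵢ / 2)` in the coordinates `xᵢ = exp qᵢ`. -/
def relVolume (q : Fin r → ℝ) : ℝ := Real.exp (1 / 2 * ∑ i, (S.d i : ℝ) * q i)

/-- The Hamiltonian `v⁻¹ J(p, p) + v ((n - 1) Λ - scalar curvature)` for Einstein constant
`Λ = 0`, in the coordinates `xᵢ = exp qᵢ`. -/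
def hamiltonian (q p : Fin r → ℝ) : ℝ :=
  (S.relVolume q)⁻¹ * S.J p p
    - S.relVolume q * S.scalarCurvature (fun i => Real.exp (q i))

/-- A superpotential: a globally defined `C²` function `u` with `H(q, du_q) = 0` for all `q`. -/
def IsSuperpotential (u : (Fin r → ℝ) → ℝ) : Prop :=
  ContDiff ℝ 2 u ∧
    ∀ q, S.hamiltonian q (fun i => fderiv ℝ u q (Pi.single i 1)) = 0

/-- The coefficient `A_w` of `exp (w · q)` in the scalar curvature function: the term
`aᵢ / xᵢ` has exponent `-eᵢ`, and `x_k / (xᵢ x_j)` has exponent `e_k - eᵢ - e_j`. -/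
def weightCoeff (w : Fin r → ℝ) : ℝ :=
  open Classical in
  1 / 2 * (∑ i, if w = -Pi.single i 1 then S.a i else 0)
    - 1 / 4 * ∑ i, ∑ j, ∑ k,
        if w = Pi.single k 1 - Pi.single i 1 - Pi.single j 1 then S.bracket i j k else 0

/-- The set `𝒲` of weight vectors: the exponents that occur in the scalar curvature function
with nonzero coefficient. -/
def weights : Set (Fin r → ℝ) := {w | S.weightCoeff w ≠ 0}

/-- The map `w ↦ w̄ = ½ (d + w)`. -/
def bar (w : Fin r → ℝ) : Fin r → ℝ := (1 / 2 : ℝ) • (S.dVec + w)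

/-- The set `½ (d + 𝒲)`. -/
def halfWeights : Set (Fin r → ℝ) := S.bar '' S.weights

/-- The polytope `conv (½ (d + 𝒲))`. -/
def polytope : Set (Fin r → ℝ) := convexHull ℝ S.halfWeights

end ScalarCurvatureData

/-- The function `∑_{c ∈ C} F_c exp (c · q)`. -/
def expSum {r : ℕ} (C : Finset (Fin r → ℝ)) (F : (Fin r → ℝ) → ℝ) (q : Fin r → ℝ) : ℝ :=
  ∑ c ∈ C, F c * Real.exp (∑ i, c i * q i)

/-! ## Perspective projection -/

section Projection

variable {r : ℕ}

/-- The affine hyperplane `{h = b}` strictly separates the point `c` from the set `P`. -/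
def Separates (h : (Fin r → ℝ) →ₗ[ℝ] ℝ) (b : ℝ) (c : Fin r → ℝ) (P : Set (Fin r → ℝ)) : Prop :=
  h c < b ∧ ∀ x ∈ P, b < h x

/-- The image `Δ^c` of `P` under the perspective projection from `c` onto the
hyperplane `{h = b}`. -/
def perspectiveImage (h : (Fin r → ℝ) →ₗ[ℝ] ℝ) (b : ℝ) (c : Fin r → ℝ)
    (P : Set (Fin r → ℝ)) : Set (Fin r → ℝ) :=
  {ξ | h ξ = b ∧ ∃ x ∈ P, ξ ∈ openSegment ℝ c x}

/-- `ξ` is a type (2) vertex of `Δ^c` (formed with the separating hyperplane `{h = b}`), and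
`VW` is the associated edge of the polytope, with `V` nearer to `c`: the vertex is not
orthogonal to `c`, and the line through `c` and `ξ` meets the polytope exactly in the
edge `VW`. -/
structure IsTypeTwoVertex (S : ScalarCurvatureData r) (h : (Fin r → ℝ) →ₗ[ℝ] ℝ) (b : ℝ)
    (c ξ V W : Fin r → ℝ) : Prop where
  separates : Separates h b c S.polytope
  vertex : ξ ∈ (perspectiveImage h b c S.polytope).extremePoints ℝ
  not_orthogonal : S.J c ξ ≠ 0
  ne : V ≠ W
  isEdge : IsExtreme ℝ S.polytope (segment ℝ V W)
  line_inter : (line[ℝ, c, ξ] : Set (Fin r → ℝ)) ∩ S.polytope = segment ℝ V W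
  nearer : dist c V < dist c W

end Projection

/-! ## Homogeneous spaces with multiplicity free isotropy representation -/

/-- Mathlib puts the Lie bracket on the Lie algebra of a group of class `minSmoothness ℝ 3`;
smooth Lie groups are such. -/
instance instLieGroupMinSmoothness {E : Type*} [NormedAddCommGroup E] [NormedSpace ℝ E]
    {G : Type*} [TopologicalSpace G] [ChartedSpace E G] [Group G] [LieGroup 𝓘(ℝ, E) ∞ G] :
    LieGroup 𝓘(ℝ, E) (minSmoothness ℝ 3) G := by
  rw [minSmoothness_of_isRCLikeNormedField]
  infer_instance

section Homogeneous

variable (E : Type*) [NormedAddCommGroup E] [NormedSpace ℝ E]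
  {G : Type*} [TopologicalSpace G] [ChartedSpace E G] [Group G]

/-- The Lie algebra `𝔤 = T₁G`. -/
abbrev LieAlg (G : Type*) [TopologicalSpace G] [ChartedSpace E G] [Group G] : Type _ :=
  GroupLieAlgebra 𝓘(ℝ, E) G

/-- The adjoint action `Ad_g` of `g ∈ G` on `𝔤`: the derivative at `1` of `x ↦ g x g⁻¹`. -/
def Ad (g : G) (X : LieAlg E G) : LieAlg E G :=
  mfderiv 𝓘(ℝ, E) 𝓘(ℝ, E) (fun x : G => g * x * g⁻¹) 1 X

/-- `X ∈ 𝔤` is the initial velocity of a one-parameter subgroup of `G` lying in `K`. -/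
def IsInitialVelocity (K : Subgroup G) (X : LieAlg E G) : Prop :=
  ∃ γ : ℝ → G, (∀ s t, γ (s + t) = γ s * γ t) ∧ (∀ t, γ t ∈ K) ∧
    ContMDiff 𝓘(ℝ, ℝ) 𝓘(ℝ, E) ∞ γ ∧ mfderiv 𝓘(ℝ, ℝ) 𝓘(ℝ, E) γ 0 (1 : ℝ) = X

/-- The Lie algebra `𝔨 ⊆ 𝔤` of the closed subgroup `K`. (For closed `K` the initial velocities
already form a linear subspace.) -/
def lieSubspace (K : Subgroup G) : Submodule ℝ (LieAlg E G) :=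
  Submodule.span ℝ {X | IsInitialVelocity E K X}

variable [LieGroup 𝓘(ℝ, E) ∞ G]

/-- An orthogonal decomposition `𝔤 = 𝔨 ⊕ 𝔭₁ ⊕ ⋯ ⊕ 𝔭_r` with respect to a bi-invariant metric
(an `Ad_G`-invariant inner product `Q`), the `𝔭ᵢ` being irreducible and pairwise inequivalent
real `Ad_K`-modules, together with a `Q`-orthonormal basis of each `𝔭ᵢ`. -/
structure IsotropyDecomposition (K : Subgroup G) (r : ℕ) where
  Q : LinearMap.BilinForm ℝ (LieAlg E G)
  Q_symm : ∀ X Y, Q X Y = Q Y X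
  Q_pos : ∀ X, X ≠ 0 → 0 < Q X X
  Q_invariant : ∀ (g : G) (X Y), Q (Ad E g X) (Ad E g Y) = Q X Y
  p : Fin r → Submodule ℝ (LieAlg E G)
  orthogonal_k : ∀ i, ∀ X ∈ lieSubspace E K, ∀ Y ∈ p i, Q X Y = 0
  orthogonal : ∀ i j, i ≠ j → ∀ X ∈ p i, ∀ Y ∈ p j, Q X Y = 0
  span_top : lieSubspace E K ⊔ (⨆ i, p i) = ⊤
  invariant : ∀ i, ∀ k ∈ K, ∀ X ∈ p i, Ad E k X ∈ p i
  ne_bot : ∀ i, p i ≠ ⊥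
  irreducible : ∀ i, ∀ q : Submodule ℝ (LieAlg E G), q ≤ p i →
    (∀ k ∈ K, ∀ X ∈ q, Ad E k X ∈ q) → q = ⊥ ∨ q = p i
  inequivalent : ∀ i j, i ≠ j → ¬ ∃ φ : p i ≃ₗ[ℝ] p j,
    ∀ k ∈ K, ∀ X Y : p i, (Y : LieAlg E G) = Ad E k (X : LieAlg E G) →
      (φ Y : LieAlg E G) = Ad E k (φ X : LieAlg E G)
  basis : ∀ i, Module.Basis (Fin (Module.finrank ℝ (p i))) ℝ (p i)
  orthonormal : ∀ i s t,
    Q (basis i s : LieAlg E G) (basis i t : LieAlg E G) = if s = t then 1 else 0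

/-- The data of the scalar curvature function of `G/K`: `dᵢ = dim 𝔭ᵢ`,
`aᵢ = -∑_α B(e_α, e_α)` over an orthonormal basis of `𝔭ᵢ`, where `B` is the Killing form, and
`[ijk] = ∑ Q([e_α, e_β], e_γ)²` over orthonormal bases of `𝔭ᵢ`, `𝔭_j`, `𝔭_k`. (Neither depends
on the choice of the bases.) -/
def IsotropyDecomposition.data {E : Type*} [NormedAddCommGroup E] [NormedSpace ℝ E]
    [CompleteSpace E]
    {G : Type*} [TopologicalSpace G] [ChartedSpace E G] [Group G] [LieGroup 𝓘(ℝ, E) ∞ G]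
    {K : Subgroup G} {r : ℕ} (D : IsotropyDecomposition E K r) : ScalarCurvatureData r where
  d i := Module.finrank ℝ (D.p i)
  a i := -∑ s, killingForm ℝ (LieAlg E G)
    (D.basis i s : LieAlg E G) (D.basis i s : LieAlg E G)
  bracket i j k := ∑ s, ∑ t, ∑ m,
    (D.Q ⁅(D.basis i s : LieAlg E G), (D.basis j t : LieAlg E G)⁆
      (D.basis k m : LieAlg E G)) ^ 2

end Homogeneous

end Superpotential

end

open Superpotential

/-!
Comparing coefficients of exponentials, `J(du, du) = v² S` becomes a system of equations
(`IsSuperpotential.sum_eq_weightCoeff`): the sum of `J(a, b) F_a F_b` over all `a, b ∈ C` with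
`a + b = x` is the coefficient `A_w` if `x = d + w` with `w ∈ 𝒲`, and zero for all other `x`. The
form `J` is Lorentzian: it is negative definite on vectors with coordinate sum zero.

*Localisation.* A linear functional that vanishes at `c` and is nonnegative on `½ (d + 𝒲)` is
nonnegative on `C` (`nonneg_of_nonneg_halfWeights`). Applied to functionals supporting the polytope
along the edge `VW`, and to small perturbations of them, this shows that the coefficient equations
at sums lying in the plane spanned by `c` and `V` involve only exponents in this plane. There `J`
is a symmetrised product of two linear functionals, one for each null direction, so these equations
describe a product of two exponential sums. Its support lies on a line parallel to the edge, hence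
so do the supports of both factors (`eq_of_level`). Parametrise the line by `c ↦ 0`, `V ↦ 1`,
`W ↦ T`. The product has precisely the exponents `2`, `1 + T`, `2 T` (`exists_hasThreeTermProduct`),
because the edge contains no points of `½ (d + 𝒲)` besides its end points and midpoint
(`eq_half_of_mem_halfWeights`).

*One variable.* The exponents of `u` on this line below `1 + T` are even integers, for want of
cancellation (`HasThreeTermProduct.exists_nat_mul`). If the largest exponent `M` were not null, it would be
`T`, hence even, and `1 + T` could not be a sum of two exponents. So `M` is the second null point of the
line, it lies beyond `W`, and a parity argument gives `M ≥ 1 + T`. The same argument, read from the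
other end of the line, gives `M ≤ 1 + T`. From `M = 1 + T` follow `W ∉ C` and `T ≥ 3`
(`HasThreeTermProduct.exists_zero`), the latter being the bound `λ = T / (T - 1) ≤ 3 / 2`. Moreover
`V` and `W` are symmetric with respect to the two null points, so `J(V, V) = J(W, W)`
(`edge_rigidity`). As `4 J(w̄, w̄) = 1 - ∑ wᵢ² / dᵢ` (`J_bar`), this gives the restrictions on the
edge.
-/

/-! ### Products of finite exponential sums -/

lemma exists_min_pair_unique {M Γ : Type*} [AddCommMonoid M] [AddCommMonoid Γ] [LinearOrder Γ]
    [IsOrderedCancelAddMonoid Γ] (κ : M → Γ) (hκ : Function.Injective κ)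
    (hadd : ∀ x y, κ (x + y) = κ x + κ y) {S T : Finset M} (hS : S.Nonempty)
    (hT : T.Nonempty) :
    ∃ a ∈ S, ∃ b ∈ T, (∀ x ∈ S, κ a ≤ κ x) ∧ (∀ y ∈ T, κ b ≤ κ y) ∧
      ∀ x ∈ S, ∀ y ∈ T, x + y = a + b → x = a ∧ y = b := by
  obtain ⟨a, ha, hamin⟩ := S.exists_min_image κ hS
  obtain ⟨b, hb, hbmin⟩ := T.exists_min_image κ hT
  refine ⟨a, ha, b, hb, hamin, hbmin, fun x hx y hy hxy => ?_⟩
  have h : κ a + κ b = κ x + κ y := by rw [← hadd, ← hadd, hxy]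
  obtain ⟨h1, h2⟩ := (add_eq_add_iff_eq_and_eq (hamin x hx) (hbmin y hy)).1 h
  exact ⟨(hκ h1).symm, (hκ h2).symm⟩

lemma sum_mul_ne_zero_of_unique {M : Type*} [Add M] [DecidableEq M] {A : Finset M}
    {p q : M → ℝ} {a b : M} (ha : a ∈ A) (hb : b ∈ A) (hpa : p a ≠ 0) (hqb : q b ≠ 0)
    (h : ∀ x ∈ A, ∀ y ∈ A, p x ≠ 0 → q y ≠ 0 → x + y = a + b → x = a ∧ y = b) :
    ∑ z ∈ A ×ˢ A with z.1 + z.2 = a + b, p z.1 * q z.2 ≠ 0 := by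
  rw [Finset.sum_eq_single (a, b)]
  · exact mul_ne_zero hpa hqb
  · rintro ⟨x, y⟩ hz hne
    simp only [Finset.mem_filter, Finset.mem_product] at hz
    by_contra h0
    obtain ⟨rfl, rfl⟩ := h x hz.1.1 y hz.1.2 (left_ne_zero_of_mul h0)
      (right_ne_zero_of_mul h0) hz.2
    exact hne rfl
  · intro hn
    simp [ha, hb] at hn

lemma exists_of_sum_mul_ne_zero {M : Type*} [Add M] [DecidableEq M] {A : Finset M}
    {p q : M → ℝ} {τ : M} (h : ∑ z ∈ A ×ˢ A with z.1 + z.2 = τ, p z.1 * q z.2 ≠ 0) :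
    ∃ x ∈ A, ∃ y ∈ A, p x ≠ 0 ∧ q y ≠ 0 ∧ x + y = τ := by
  obtain ⟨⟨x, y⟩, hz, h0⟩ := Finset.exists_ne_zero_of_sum_ne_zero h
  simp only [Finset.mem_filter, Finset.mem_product] at hz
  exact ⟨x, hz.1.1, y, hz.1.2, left_ne_zero_of_mul h0, right_ne_zero_of_mul h0, hz.2⟩

/-! ### Exponential sums in one variable whose product has three equally spaced terms -/

lemma exists_min_sum_ne_zero {A : Finset ℝ} {p q : ℝ → ℝ} (hp : ∃ t ∈ A, p t ≠ 0)
    (hq : ∃ t ∈ A, q t ≠ 0) :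
    ∃ a ∈ A, ∃ b ∈ A, p a ≠ 0 ∧ q b ≠ 0 ∧ (∀ t ∈ A, p t ≠ 0 → a ≤ t) ∧
      (∀ t ∈ A, q t ≠ 0 → b ≤ t) ∧
      ∑ z ∈ A ×ˢ A with z.1 + z.2 = a + b, p z.1 * q z.2 ≠ 0 := by
  obtain ⟨a, ha, b, hb, ham, hbm, hu⟩ := exists_min_pair_unique (fun t : ℝ => t)
    (fun _ _ h => h) (fun _ _ => rfl)
    (S := A.filter (fun t => p t ≠ 0)) (T := A.filter (fun t => q t ≠ 0))
    (by obtain ⟨t, h1, h2⟩ := hp; exact ⟨t, by simp [h1, h2]⟩)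
    (by obtain ⟨t, h1, h2⟩ := hq; exact ⟨t, by simp [h1, h2]⟩)
  simp only [Finset.mem_filter, and_imp] at ha hb ham hbm hu
  exact ⟨a, ha.1, b, hb.1, ha.2, hb.2, ham, hbm,
    sum_mul_ne_zero_of_unique ha.1 hb.1 ha.2 hb.2
      fun x hx y hy hpx hqy h => hu x hx hpx y hy hqy h⟩

lemma exists_max_sum_ne_zero {A : Finset ℝ} {p q : ℝ → ℝ} (hp : ∃ t ∈ A, p t ≠ 0)
    (hq : ∃ t ∈ A, q t ≠ 0) :
    ∃ a ∈ A, ∃ b ∈ A, p a ≠ 0 ∧ q b ≠ 0 ∧ (∀ t ∈ A, p t ≠ 0 → t ≤ a) ∧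
      (∀ t ∈ A, q t ≠ 0 → t ≤ b) ∧
      ∑ z ∈ A ×ˢ A with z.1 + z.2 = a + b, p z.1 * q z.2 ≠ 0 := by
  obtain ⟨a, ha, b, hb, ham, hbm, hu⟩ := exists_min_pair_unique (fun t : ℝ => -t)
    neg_injective (fun x y => neg_add x y)
    (S := A.filter (fun t => p t ≠ 0)) (T := A.filter (fun t => q t ≠ 0))
    (by obtain ⟨t, h1, h2⟩ := hp; exact ⟨t, by simp [h1, h2]⟩)
    (by obtain ⟨t, h1, h2⟩ := hq; exact ⟨t, by simp [h1, h2]⟩)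
  simp only [Finset.mem_filter, and_imp, neg_le_neg_iff] at ha hb ham hbm hu
  exact ⟨a, ha.1, b, hb.1, ha.2, hb.2, ham, hbm,
    sum_mul_ne_zero_of_unique ha.1 hb.1 ha.2 hb.2
      fun x hx y hy hpx hqy h => hu x hx hpx y hy hqy h⟩

/-- The exponents occurring in the product of `∑ p t z ^ t` and `∑ q t z ^ t`, `t ∈ A`, are
`2 x`, `x + y` and `2 y`. -/
def HasThreeTermProduct (A : Finset ℝ) (p q : ℝ → ℝ) (x y : ℝ) : Prop :=
  ∀ τ, ∑ z ∈ A ×ˢ A with z.1 + z.2 = τ, p z.1 * q z.2 ≠ 0 ↔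
    τ = 2 * x ∨ τ = x + y ∨ τ = 2 * y

namespace HasThreeTermProduct

variable {A : Finset ℝ} {p q : ℝ → ℝ} {x y : ℝ}

lemma exists_q_ne_zero (hR : HasThreeTermProduct A p q x y) : ∃ t ∈ A, q t ≠ 0 := by
  obtain ⟨_, _, t, ht, _, h, _⟩ := exists_of_sum_mul_ne_zero ((hR (2 * x)).2 (Or.inl rfl))
  exact ⟨t, ht, h⟩

/-- The smallest exponents of the two factors add up to `2 x`; as `p` does not vanish at `0`
and `q` vanishes only there, they are `0` and `2 x`. -/
lemma eq_zero_or_two_mul_le (hR : HasThreeTermProduct A p q x y) (hxy : x < y)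
    (h0 : 0 ∈ A) (hp0 : p 0 ≠ 0) (hq : ∀ t ∈ A, q t = 0 ↔ t = 0) :
    ∀ t ∈ A, t = 0 ∨ 2 * x ≤ t := by
  obtain ⟨a, ha, b, hb, hpa, hqb, ham, hbm, hne⟩ :=
    exists_min_sum_ne_zero ⟨0, h0, hp0⟩ hR.exists_q_ne_zero
  have hab : 2 * x ≤ a + b := by
    rcases (hR _).1 hne with h | h | h <;> linarith
  have ha0 := ham 0 h0 hp0
  intro t ht
  by_cases h : t = 0
  · exact Or.inl h
  · have := hbm t ht (fun h' => h ((hq t ht).1 h'))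
    right; linarith

/-- Below the middle exponent `x + y` no cancellation is possible, so the exponents there
are generated by the smallest nonzero one. -/
lemma exists_nat_mul (hR : HasThreeTermProduct A p q x y) (hx : 0 < x) (hxy : x < y)
    (h0 : 0 ∈ A) (hp0 : p 0 ≠ 0) (hq : ∀ t ∈ A, q t = 0 ↔ t = 0) :
    ∀ t ∈ A, t < x + y → ∃ k : ℕ, t = 2 * x * k := by
  have hge := hR.eq_zero_or_two_mul_le hxy h0 hp0 hq
  classical
  by_contra! hcon
  obtain ⟨t₁, ht₁, hlt₁, hk₁⟩ := hcon
  obtain ⟨t, ht, hmin⟩ := (A.filter (fun t => t < x + y ∧ ∀ k : ℕ, t ≠ 2 * x * k)).exists_min_image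
    id ⟨t₁, by simp only [Finset.mem_filter]; exact ⟨ht₁, hlt₁, hk₁⟩⟩
  simp only [Finset.mem_filter, id, and_imp] at ht hmin
  obtain ⟨htA, htlt, htk⟩ := ht
  have ht0 : t ≠ 0 := by simpa using htk 0
  have hne : ∑ z ∈ A ×ˢ A with z.1 + z.2 = 0 + t, p z.1 * q z.2 ≠ 0 := by
    refine sum_mul_ne_zero_of_unique h0 htA hp0 (fun h => ht0 ((hq t htA).1 h)) ?_
    intro s hs s' hs' _ hqs hsum
    have hs'0 : s' ≠ 0 := fun h => hqs ((hq s' hs').2 h)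
    have hs'2 := (hge s' hs').resolve_left hs'0
    rcases hge s hs with h | h
    · exact ⟨h, by linarith⟩
    · exfalso
      have key : ∀ v ∈ A, v < t → ∃ k : ℕ, v = 2 * x * k := by
        intro v hv hvt
        by_contra! hno
        exact absurd (hmin v hv (hvt.trans htlt) hno) (not_le.2 hvt)
      obtain ⟨k, hk⟩ := key s hs (by linarith)
      obtain ⟨k', hk'⟩ := key s' hs' (by linarith)
      exact htk (k + k') (by push_cast; linarith)
  rcases (hR _).1 hne with h | h | h
  · exact htk 1 (by push_cast; linarith)
  · linarith
  · linarith

lemma middle_exists_nat_mul (hR : HasThreeTermProduct A p q x y) (hx : 0 < x) (hxy : x < y)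
    (h0 : 0 ∈ A) (hp0 : p 0 ≠ 0) (hq : ∀ t ∈ A, q t = 0 ↔ t = 0)
    (hlt : ∀ t ∈ A, t < x + y) : ∃ k : ℕ, x + y = 2 * x * k := by
  obtain ⟨s, hs, s', hs', _, _, hsum⟩ :=
    exists_of_sum_mul_ne_zero ((hR (x + y)).2 (Or.inr (Or.inl rfl)))
  obtain ⟨k, hk⟩ := hR.exists_nat_mul hx hxy h0 hp0 hq s hs (hlt s hs)
  obtain ⟨k', hk'⟩ := hR.exists_nat_mul hx hxy h0 hp0 hq s' hs' (hlt s' hs')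
  exact ⟨k + k', by push_cast; linarith⟩

lemma add_le_of_mem (hR : HasThreeTermProduct A p q x y) (hx : 0 < x) (hxy : x < y)
    (h0 : 0 ∈ A) (hp0 : p 0 ≠ 0) (hq : ∀ t ∈ A, q t = 0 ↔ t = 0) {M : ℝ}
    (hM : M ∈ A) (hmax : ∀ t ∈ A, t ≤ M) (hyM : y < M) : x + y ≤ M := by
  by_contra! hlt
  -- All exponents are multiples of `2 x`, and `y` is an odd multiple of `x` less than `M`.
  obtain ⟨k, hk⟩ := hR.middle_exists_nat_mul hx hxy h0 hp0 hq
    fun t ht => (hmax t ht).trans_lt hlt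
  obtain ⟨m, hm⟩ := hR.exists_nat_mul hx hxy h0 hp0 hq M hM hlt
  have h1 : (m : ℝ) < k := by
    by_contra! h
    nlinarith
  have h2 : (m : ℝ) + 1 ≤ k := by exact_mod_cast h1
  nlinarith

lemma reflect (hR : HasThreeTermProduct A p q x y) (M : ℝ) :
    HasThreeTermProduct (A.image (fun t => M - t)) (fun t => q (M - t)) (fun t => p (M - t))
      (M - y) (M - x) := by
  intro τ
  have h : ∑ z ∈ (A.image (fun t => M - t)) ×ˢ (A.image (fun t => M - t)) with z.1 + z.2 = τ,
      q (M - z.1) * p (M - z.2) =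
      ∑ z ∈ A ×ˢ A with z.1 + z.2 = 2 * M - τ, p z.1 * q z.2 := by
    refine Finset.sum_nbij' (fun z => (M - z.2, M - z.1)) (fun z => (M - z.2, M - z.1))
      ?_ ?_ ?_ ?_ ?_
    · rintro ⟨s, t⟩ h
      simp only [Finset.mem_filter, Finset.mem_product, Finset.mem_image] at h ⊢
      obtain ⟨⟨⟨s', hs', rfl⟩, ⟨t', ht', rfl⟩⟩, hst⟩ := h
      simp only [sub_sub_cancel]
      exact ⟨⟨ht', hs'⟩, by linarith⟩
    · rintro ⟨s, t⟩ h
      simp only [Finset.mem_filter, Finset.mem_product, Finset.mem_image] at h ⊢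
      exact ⟨⟨⟨t, h.1.2, rfl⟩, ⟨s, h.1.1, rfl⟩⟩, by linarith [h.2]⟩
    · simp
    · simp
    · intro z _
      exact mul_comm _ _
  rw [h, hR]
  constructor
  · rintro (h | h | h)
    · right; right; linarith
    · right; left; linarith
    · left; linarith
  · rintro (h | h | h)
    · right; right; linarith
    · right; left; linarith
    · left; linarith

/-- If `q` vanishes exactly at `0 ∈ A` and `p` vanishes at most at one point of `A`, different
from `0`, then `p` does vanish at the largest exponent, which is `x + y`. The lower bound for
this exponent and its mirror image together determine it. -/
lemma exists_zero (hR : HasThreeTermProduct A p q x y) (hx : 0 < x) (hxy : x < y)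
    (h0 : 0 ∈ A) (hp0 : p 0 ≠ 0) (hq : ∀ t ∈ A, q t = 0 ↔ t = 0)
    (hp : ∀ s ∈ A, ∀ t ∈ A, p s = 0 → p t = 0 → s = t) :
    x + y ∈ A ∧ p (x + y) = 0 ∧ y ∉ A ∧ 3 * x ≤ y := by
  have hge := hR.eq_zero_or_two_mul_le hxy h0 hp0 hq
  obtain ⟨M', hM', M, hM, hpM', hqM, hmaxp, hmaxq, hne⟩ :=
    exists_max_sum_ne_zero ⟨0, h0, hp0⟩ hR.exists_q_ne_zero
  have hM0 : M ≠ 0 := fun h => hqM ((hq M hM).2 h)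
  have hM2 := (hge M hM).resolve_left hM0
  have hmax : ∀ t ∈ A, t ≤ M := by
    intro t ht
    rcases hge t ht with h | h
    · linarith
    · exact hmaxq t ht fun h' => by linarith [(hq t ht).1 h']
  have hsum : M' + M = 2 * y := by
    -- `2 y` is the largest exponent of the product.
    obtain ⟨s, hs, t, ht, hps, hqt, hst⟩ :=
      exists_of_sum_mul_ne_zero ((hR (2 * y)).2 (Or.inr (Or.inr rfl)))
    have h1 := hmaxp s hs hps
    have h2 := hmax t ht
    rcases (hR _).1 hne with h | h | h <;> linarith
  have hpM : p M = 0 := by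
    by_contra hpM
    have hMM' : M' = M := le_antisymm (hmax M' hM') (hmaxp M hM hpM)
    have hMy : M = y := by linarith
    have hlt : ∀ t ∈ A, t < x + y := fun t ht => by linarith [hmax t ht]
    obtain ⟨k, hk⟩ := hR.middle_exists_nat_mul hx hxy h0 hp0 hq hlt
    obtain ⟨m, hm⟩ := hR.exists_nat_mul hx hxy h0 hp0 hq M hM (hlt M hM)
    have h1 : x * (2 * m + 1) = x * (2 * k) := by nlinarith
    have h2 : (2 * m + 1 : ℝ) = 2 * k := mul_left_cancel₀ hx.ne' h1
    have h3 : 2 * m + 1 = 2 * k := by exact_mod_cast h2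
    omega
  have hMlt : M' < M := lt_of_le_of_ne (hmax M' hM') fun h => hpM' (h ▸ hpM)
  have hyM : y < M := by linarith
  have hle := hR.add_le_of_mem hx hxy h0 hp0 hq hM hmax hyM
  have hle' := (hR.reflect M).add_le_of_mem (M := M) (by linarith) (by linarith)
    (Finset.mem_image.2 ⟨M, hM, sub_self M⟩) (by simpa using hqM)
    (by
      intro t ht
      obtain ⟨s, hs, rfl⟩ := Finset.mem_image.1 ht
      simp only [sub_sub_cancel]
      exact ⟨fun h => by linarith [hp s hs M hM h hpM], fun h => by
        rwa [show s = M by linarith]⟩)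
    (Finset.mem_image.2 ⟨0, h0, sub_zero M⟩)
    (by
      intro t ht
      obtain ⟨s, hs, rfl⟩ := Finset.mem_image.1 ht
      rcases hge s hs with h | h <;> linarith)
    (by linarith)
  have hMeq : M = x + y := by linarith
  have hM'0 : M' ≠ 0 := by
    intro h
    linarith
  refine ⟨hMeq ▸ hM, hMeq ▸ hpM, fun hy => ?_, ?_⟩
  · have := hmaxp y hy fun h => by linarith [hp y hy M hM h hpM]
    linarith
  · have := (hge M' hM').resolve_left hM'0
    linarith

end HasThreeTermProduct

namespace Superpotential.ScalarCurvatureData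

/-! ### The equations for the coefficients of a superpotential -/

section Equations

variable {r : ℕ} (S : ScalarCurvatureData r)

/-- The exponential function `q ↦ exp (x · q)`, as a character of the additive group `ℝ ^ r`. -/
noncomputable def expCharacter (x : Fin r → ℝ) : Multiplicative (Fin r → ℝ) →* ℝ where
  toFun q := Real.exp (∑ i, x i * q.toAdd i)
  map_one' := by simp
  map_mul' q q' := by
    rw [← Real.exp_add, ← Finset.sum_add_distrib]
    simp [mul_add]

lemma expCharacter_injective : Function.Injective (expCharacter (r := r)) := by
  intro x y hxy
  ext i
  have := DFunLike.congr_fun hxy (Multiplicative.ofAdd (Pi.single i 1))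
  simpa [expCharacter, Pi.single_apply] using this

/-- The exponential sum with coefficients `g`. -/
noncomputable def finsuppExpSum (g : (Fin r → ℝ) →₀ ℝ) (q : Fin r → ℝ) : ℝ :=
  g.sum fun x t => t * Real.exp (∑ i, x i * q i)

lemma finsuppExpSum_injective : Function.Injective (finsuppExpSum (r := r)) := by
  have hli : LinearIndependent ℝ
      (fun x : Fin r → ℝ => (expCharacter x : Multiplicative (Fin r → ℝ) → ℝ)) :=
    (linearIndependent_monoidHom (Multiplicative (Fin r → ℝ)) ℝ).comp _ expCharacter_injective
  intro g g' h
  apply hli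
  funext q
  have := congrFun h q.toAdd
  simpa [finsuppExpSum, Finsupp.linearCombination_apply, Finsupp.sum, expCharacter] using this

lemma finsuppExpSum_single (x : Fin r → ℝ) (t : ℝ) (q : Fin r → ℝ) :
    finsuppExpSum (Finsupp.single x t) q = t * Real.exp (∑ i, x i * q i) := by
  simp [finsuppExpSum]

lemma finsuppExpSum_add (g g' : (Fin r → ℝ) →₀ ℝ) (q : Fin r → ℝ) :
    finsuppExpSum (g + g') q = finsuppExpSum g q + finsuppExpSum g' q :=
  Finsupp.sum_add_index' (by simp) (by intros; ring)

lemma finsuppExpSum_sum {ι : Type*} (s : Finset ι) (g : ι → (Fin r → ℝ) →₀ ℝ)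
    (q : Fin r → ℝ) : finsuppExpSum (∑ m ∈ s, g m) q = ∑ m ∈ s, finsuppExpSum (g m) q := by
  classical
  induction s using Finset.induction_on with
  | empty => simp [finsuppExpSum]
  | insert a s ha ih => rw [Finset.sum_insert ha, Finset.sum_insert ha, finsuppExpSum_add, ih]

lemma fderiv_expSum_single (C : Finset (Fin r → ℝ)) (F : (Fin r → ℝ) → ℝ) (q : Fin r → ℝ)
    (i : Fin r) :
    fderiv ℝ (expSum C F) q (Pi.single i 1) =
      ∑ c ∈ C, F c * c i * Real.exp (∑ j, c j * q j) := by
  have h : HasFDerivAt (expSum C F)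
      (∑ c ∈ C, F c • (Real.exp (∑ j, c j * q j) •
        ∑ j, c j • (ContinuousLinearMap.proj j : (Fin r → ℝ) →L[ℝ] ℝ))) q := by
    unfold expSum
    refine HasFDerivAt.fun_sum fun c _ => ?_
    refine HasFDerivAt.const_mul (HasFDerivAt.exp ?_) _
    refine HasFDerivAt.fun_sum fun j _ => ?_
    exact (ContinuousLinearMap.proj (R := ℝ) (φ := fun _ : Fin r => ℝ) j).hasFDerivAt.const_mul _
  rw [h.fderiv]
  simp [Pi.single_apply]
  refine Finset.sum_congr rfl fun c _ => by ring

lemma J_comm (x y : Fin r → ℝ) : S.J x y = S.J y x := by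
  simp only [J, mul_comm]

lemma J_add_right (x y z : Fin r → ℝ) : S.J x (y + z) = S.J x y + S.J x z := by
  simp only [J, Pi.add_apply, Finset.sum_add_distrib, mul_add, add_div]
  ring

lemma J_smul_right (t : ℝ) (x y : Fin r → ℝ) : S.J x (t • y) = t * S.J x y := by
  simp only [J, Pi.smul_apply, smul_eq_mul, ← Finset.mul_sum]
  have : ∀ i, x i * (t * y i) / (S.d i : ℝ) = t * (x i * y i / S.d i) := fun i => by ring
  simp only [this, ← Finset.mul_sum]
  ring

/-- The linear functional `J(x, ·)`. -/
noncomputable def JLeft (x : Fin r → ℝ) : (Fin r → ℝ) →ₗ[ℝ] ℝ where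
  toFun := S.J x
  map_add' := S.J_add_right x
  map_smul' t y := S.J_smul_right t x y

lemma J_sum_right {ι : Type*} (s : Finset ι) (x : Fin r → ℝ) (f : ι → Fin r → ℝ) :
    S.J x (∑ m ∈ s, f m) = ∑ m ∈ s, S.J x (f m) := map_sum (S.JLeft x) f s

lemma J_add_left (x y z : Fin r → ℝ) : S.J (x + y) z = S.J x z + S.J y z := by
  rw [J_comm, J_add_right, J_comm, S.J_comm z y]

lemma J_smul_left (t : ℝ) (x y : Fin r → ℝ) : S.J (t • x) y = t * S.J x y := by
  rw [J_comm, J_smul_right, J_comm]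

lemma J_sub_right (x y z : Fin r → ℝ) : S.J x (y - z) = S.J x y - S.J x z :=
  map_sub (S.JLeft x) y z

lemma J_sub_left (x y z : Fin r → ℝ) : S.J (x - y) z = S.J x z - S.J y z := by
  rw [J_comm, J_sub_right, J_comm, S.J_comm z y]

/-- The coefficients of the exponential sum `v² S`, where `S` is the scalar curvature. -/
noncomputable def curvatureCoeffs : (Fin r → ℝ) →₀ ℝ :=
  (∑ i, Finsupp.single (S.dVec + -Pi.single i 1) (1 / 2 * S.a i)) +
    ∑ i, ∑ j, ∑ k, Finsupp.single (S.dVec + (Pi.single k 1 - Pi.single i 1 - Pi.single j 1))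
      (-(1 / 4) * S.bracket i j k)

lemma curvatureCoeffs_apply (x : Fin r → ℝ) :
    S.curvatureCoeffs x = S.weightCoeff (x - S.dVec) := by
  classical
  have h : ∀ y : Fin r → ℝ, (S.dVec + y = x) ↔ (x - S.dVec = y) := fun y => by
    rw [sub_eq_iff_eq_add', eq_comm]
  rw [curvatureCoeffs, weightCoeff, sub_eq_add_neg, Finsupp.add_apply]
  simp only [Finsupp.finsetSum_apply, Finset.mul_sum, ← Finset.sum_neg_distrib]
  congr 1
  · refine Finset.sum_congr rfl fun i _ => ?_
    rw [Finsupp.single_apply, mul_ite, mul_zero]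
    exact if_congr (h _) rfl rfl
  · refine Finset.sum_congr rfl fun i _ => Finset.sum_congr rfl fun j _ =>
      Finset.sum_congr rfl fun k _ => ?_
    rw [Finsupp.single_apply]
    by_cases hx : x - S.dVec = Pi.single k 1 - Pi.single i 1 - Pi.single j 1
    · rw [if_pos ((h _).2 hx), if_pos hx, neg_mul]
    · rw [if_neg (mt (h _).1 hx), if_neg hx, mul_zero, neg_zero]

lemma finsuppExpSum_curvatureCoeffs (q : Fin r → ℝ) :
    finsuppExpSum S.curvatureCoeffs q =
      S.relVolume q ^ 2 * S.scalarCurvature fun i => Real.exp (q i) := by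
  have hv : S.relVolume q ^ 2 = Real.exp (∑ i, S.dVec i * q i) := by
    rw [relVolume, ← Real.exp_nat_mul]
    congr 1
    simp only [dVec]
    push_cast
    ring
  have hsplit : ∀ y : Fin r → ℝ, Real.exp (∑ i, (S.dVec + y) i * q i) =
      S.relVolume q ^ 2 * Real.exp (∑ i, y i * q i) := fun y => by
    rw [hv, ← Real.exp_add, ← Finset.sum_add_distrib]
    simp [add_mul]
  simp only [curvatureCoeffs, finsuppExpSum_add, finsuppExpSum_sum, finsuppExpSum_single, hsplit]
  rw [scalarCurvature, mul_sub, sub_eq_add_neg]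
  congr 1
  · simp only [Finset.mul_sum]
    refine Finset.sum_congr rfl fun i _ => ?_
    simp [Pi.single_apply, Real.exp_neg]
    ring
  · simp only [Finset.mul_sum, ← Finset.sum_neg_distrib]
    refine Finset.sum_congr rfl fun i _ => Finset.sum_congr rfl fun j _ =>
      Finset.sum_congr rfl fun k _ => ?_
    simp [Pi.single_apply, Real.exp_sub, sub_mul, Finset.sum_sub_distrib]
    field_simp

lemma J_sum_sum (C : Finset (Fin r → ℝ)) (G : (Fin r → ℝ) → ℝ) :
    S.J (∑ c ∈ C, G c • c) (∑ c ∈ C, G c • c) =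
      ∑ z ∈ C ×ˢ C, S.J z.1 z.2 * G z.1 * G z.2 := by
  rw [Finset.sum_product, J_comm, J_sum_right]
  refine Finset.sum_congr rfl fun x _ => ?_
  rw [J_comm, J_sum_right]
  refine Finset.sum_congr rfl fun y _ => ?_
  rw [J_smul_left, J_smul_right]
  ring

/-- Comparing coefficients in `J(du, du) = v² S`. -/
lemma IsSuperpotential.sum_eq_weightCoeff {S : ScalarCurvatureData r} {C : Finset (Fin r → ℝ)}
    {F : (Fin r → ℝ) → ℝ} (hu : S.IsSuperpotential (expSum C F)) (x : Fin r → ℝ) :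
    ∑ z ∈ C ×ˢ C with z.1 + z.2 = x, S.J z.1 z.2 * F z.1 * F z.2 =
      S.weightCoeff (x - S.dVec) := by
  have key : (∑ z ∈ C ×ˢ C, Finsupp.single (z.1 + z.2) (S.J z.1 z.2 * F z.1 * F z.2)) =
      S.curvatureCoeffs := by
    apply finsuppExpSum_injective
    funext q
    rw [finsuppExpSum_curvatureCoeffs, finsuppExpSum_sum]
    have hv : S.relVolume q ≠ 0 := (Real.exp_pos _).ne'
    have h := hu.2 q
    have hgrad : (fun i => fderiv ℝ (expSum C F) q (Pi.single i 1)) =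
        ∑ c ∈ C, (F c * Real.exp (∑ j, c j * q j)) • c := by
      funext i
      rw [fderiv_expSum_single, Finset.sum_apply]
      refine Finset.sum_congr rfl fun c _ => ?_
      rw [Pi.smul_apply, smul_eq_mul]
      ring
    rw [hamiltonian, hgrad, S.J_sum_sum, sub_eq_zero] at h
    have h' : ∑ z ∈ C ×ˢ C, finsuppExpSum
        (Finsupp.single (z.1 + z.2) (S.J z.1 z.2 * F z.1 * F z.2)) q =
        ∑ z ∈ C ×ˢ C, S.J z.1 z.2 * (F z.1 * Real.exp (∑ j, z.1 j * q j)) *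
          (F z.2 * Real.exp (∑ j, z.2 j * q j)) := by
      refine Finset.sum_congr rfl fun z _ => ?_
      rw [finsuppExpSum_single]
      simp only [Pi.add_apply, add_mul, Finset.sum_add_distrib, Real.exp_add]
      ring
    rw [h']
    rw [inv_mul_eq_iff_eq_mul₀ hv] at h
    rw [h]
    ring
  rw [← curvatureCoeffs_apply, ← key, Finsupp.finsetSum_apply]
  simp only [Finsupp.single_apply, Finset.sum_filter]

end Equations

/-! ### Weights -/

section Weights

variable {r : ℕ} (S : ScalarCurvatureData r)

lemma exists_of_mem_weights {w : Fin r → ℝ} (hw : w ∈ S.weights) :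
    (∃ i, w = -Pi.single i 1) ∨
      ∃ i j k, w = Pi.single k 1 - Pi.single i 1 - Pi.single j 1 := by
  by_contra! h
  apply hw
  simp [weightCoeff, h.1, h.2]

lemma weights_finite : S.weights.Finite := by
  refine ((Set.finite_range fun i : Fin r => -Pi.single (M := fun _ => ℝ) i 1).union
    (Set.finite_range fun m : Fin r × Fin r × Fin r =>
      Pi.single (M := fun _ => ℝ) m.2.2 1 - Pi.single m.1 1 - Pi.single m.2.1 1)).subset ?_
  intro w hw
  rcases S.exists_of_mem_weights hw with ⟨i, rfl⟩ | ⟨i, j, k, rfl⟩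
  · exact Or.inl ⟨i, rfl⟩
  · exact Or.inr ⟨(i, j, k), rfl⟩

lemma halfWeights_finite : S.halfWeights.Finite := S.weights_finite.image _

lemma sum_of_mem_weights {w : Fin r → ℝ} (hw : w ∈ S.weights) : ∑ i, w i = -1 := by
  rcases S.exists_of_mem_weights hw with ⟨i, rfl⟩ | ⟨i, j, k, rfl⟩
  · simp
  · simp [Finset.sum_sub_distrib]

lemma sum_of_mem_halfWeights {x : Fin r → ℝ} (hx : x ∈ S.halfWeights) :
    ∑ i, x i = (S.n - 1) / 2 := by
  obtain ⟨w, hw, rfl⟩ := hx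
  have := S.sum_of_mem_weights hw
  simp only [bar, dVec, n, Pi.smul_apply, Pi.add_apply, smul_eq_mul, ← Finset.mul_sum,
    Finset.sum_add_distrib, this]
  ring

lemma exists_int_of_mem_weights {w : Fin r → ℝ} (hw : w ∈ S.weights) (m : Fin r) :
    ∃ z : ℤ, w m = z ∧ -2 ≤ z ∧ z ≤ 1 := by
  have h : ∀ i : Fin r, ∃ z : ℤ, Pi.single (M := fun _ => ℝ) i 1 m = z ∧ 0 ≤ z ∧ z ≤ 1 := by
    intro i
    rw [Pi.single_apply]
    split_ifs
    · exact ⟨1, by simp⟩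
    · exact ⟨0, by simp⟩
  rcases S.exists_of_mem_weights hw with ⟨i, rfl⟩ | ⟨i, j, k, rfl⟩
  · obtain ⟨z, hz, h0, h1⟩ := h i
    exact ⟨-z, by simp [hz], by omega, by omega⟩
  · obtain ⟨z, hz, h0, h1⟩ := h i
    obtain ⟨z', hz', h0', h1'⟩ := h j
    obtain ⟨z'', hz'', h0'', h1''⟩ := h k
    exact ⟨z'' - z - z', by simp [hz, hz', hz''], by omega, by omega⟩

/-- A vector is in `d + 𝒲` iff its half is in `½ (d + 𝒲)`. -/
lemma weightCoeff_ne_zero_iff (x : Fin r → ℝ) :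
    S.weightCoeff (x - S.dVec) ≠ 0 ↔ (1 / 2 : ℝ) • x ∈ S.halfWeights := by
  constructor
  · intro h
    exact ⟨x - S.dVec, h, by simp [bar]⟩
  · rintro ⟨w, hw, h⟩
    have : x = S.dVec + w := by
      have := smul_right_injective (Fin r → ℝ) (show (1 / 2 : ℝ) ≠ 0 by norm_num) h
      exact this.symm
    rw [this, add_sub_cancel_left]
    exact hw

/-- The only points of `½ (d + 𝒲)` on a segment whose end points and midpoint belong to it are
these three: the coordinates of weights are integers in `[-2, 1]`, so the half difference of the
end points of the corresponding segment of weights has coordinates in `{-1, 0, 1}`. -/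
lemma eq_half_of_mem_halfWeights {V W : Fin r → ℝ} (hne : V ≠ W) (hV : V ∈ S.halfWeights)
    (hW : W ∈ S.halfWeights) (hm : midpoint ℝ V W ∈ S.halfWeights) {t : ℝ}
    (ht : V + t • (W - V) ∈ S.halfWeights) (h0 : 0 < t) (h1 : t < 1) : t = 1 / 2 := by
  obtain ⟨v, hv, rfl⟩ := hV
  obtain ⟨w, hw, rfl⟩ := hW
  obtain ⟨m, hmw, hm⟩ := hm
  obtain ⟨x, hx, hxt⟩ := ht
  obtain ⟨i, hi⟩ : ∃ i, v i ≠ w i := by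
    by_contra! h
    exact hne (by rw [funext h])
  obtain ⟨zv, hzv, _, _⟩ := S.exists_int_of_mem_weights hv i
  obtain ⟨zw, hzw, _, _⟩ := S.exists_int_of_mem_weights hw i
  obtain ⟨zm, hzm, _, _⟩ := S.exists_int_of_mem_weights hmw i
  obtain ⟨zx, hzx, _, _⟩ := S.exists_int_of_mem_weights hx i
  have e1 := congrFun hm i
  have e2 := congrFun hxt i
  simp only [bar, midpoint_eq_smul_add, Pi.smul_apply, Pi.add_apply, Pi.sub_apply,
    smul_eq_mul, hzv, hzw, hzm, hzx] at e1 e2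
  rw [hzv, hzw] at hi
  have e1' : (2 * zm : ℝ) = zv + zw := by simp at e1; linarith
  have e2' : (zx : ℝ) = zv + t * (zw - zv) := by linarith
  have e1z : 2 * zm = zv + zw := by exact_mod_cast e1'
  have hiz : zv ≠ zw := by exact_mod_cast hi
  have hcase : zw - zv = 2 ∨ zw - zv = -2 := by omega
  rcases hcase with h | h
  · have h' : (zw - zv : ℝ) = 2 := by exact_mod_cast h
    rw [h'] at e2'
    have a1 : (zv : ℝ) < zx := by linarith
    have a2 : (zx : ℝ) < zv + 2 := by linarith
    have b1 : zv < zx := by exact_mod_cast a1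
    have b2 : zx < zv + 2 := by exact_mod_cast a2
    have b3 : (zx : ℝ) = zv + 1 := by exact_mod_cast (show zx = zv + 1 by omega)
    linarith
  · have h' : (zw - zv : ℝ) = -2 := by exact_mod_cast h
    rw [h'] at e2'
    have a1 : (zx : ℝ) < zv := by linarith
    have a2 : (zv : ℝ) - 2 < zx := by linarith
    have b1 : zx < zv := by exact_mod_cast a1
    have b2 : zv - 2 < zx := by exact_mod_cast a2
    have b3 : (zx : ℝ) = zv - 1 := by exact_mod_cast (show zx = zv - 1 by omega)
    linarith

end Weights

end Superpotential.ScalarCurvatureData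

namespace Superpotential.ScalarCurvatureData

/-! ### The support of a superpotential with a null exponent -/

section Support

variable {r : ℕ} (S : ScalarCurvatureData r)

/-- The form `J` is negative definite on vectors with vanishing coordinate sum. -/
lemma eq_zero_of_sum_eq_zero (hd : ∀ i, 0 < S.d i) {x : Fin r → ℝ} (hsum : ∑ i, x i = 0)
    (hx : S.J x x = 0) : x = 0 := by
  have h : ∑ i, x i * x i / (S.d i : ℝ) = 0 := by simpa [J, hsum] using hx
  have hpos : ∀ i, (0 : ℝ) < S.d i := fun i => by exact_mod_cast hd i
  rw [Finset.sum_eq_zero_iff_of_nonneg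
    fun i _ => div_nonneg (mul_self_nonneg _) (hpos i).le] at h
  ext i
  have := h i (Finset.mem_univ i)
  rw [div_eq_zero_iff, or_iff_left (hpos i).ne'] at this
  simpa using this

/-- Orthogonal null vectors of a Lorentzian form are proportional. -/
lemma exists_eq_smul_of_null (hd : ∀ i, 0 < S.d i) {a c : Fin r → ℝ} (hc0 : c ≠ 0)
    (hc : S.J c c = 0) (ha : S.J a a = 0) (hac : S.J a c = 0) : ∃ t : ℝ, a = t • c := by
  have hs : ∑ i, c i ≠ 0 := fun h => hc0 (S.eq_zero_of_sum_eq_zero hd h hc)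
  refine ⟨(∑ i, a i) / ∑ i, c i, sub_eq_zero.1 (S.eq_zero_of_sum_eq_zero hd ?_ ?_)⟩
  · simp only [Pi.sub_apply, Pi.smul_apply, smul_eq_mul, Finset.sum_sub_distrib,
      ← Finset.mul_sum]
    field_simp
    ring
  · simp [J_sub_left, J_sub_right, J_smul_left, J_smul_right, ha, hc, hac, S.J_comm c a]

/-- A total ordering of `ℝ ^ r`, compatible with addition, that refines the preorder given by
a linear functional. -/
def lexKey (f : (Fin r → ℝ) →ₗ[ℝ] ℝ) (x : Fin r → ℝ) : ℝ ×ₗ Lex (Fin r → ℝ) :=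
  toLex (f x, toLex x)

lemma lexKey_injective (f : (Fin r → ℝ) →ₗ[ℝ] ℝ) : Function.Injective (lexKey f) := by
  intro x y h
  have := (Prod.mk.inj (toLex.injective h)).2
  exact toLex.injective this

lemma lexKey_add (f : (Fin r → ℝ) →ₗ[ℝ] ℝ) (x y : Fin r → ℝ) :
    lexKey f (x + y) = lexKey f x + lexKey f y := by
  simp only [lexKey, map_add, toLex_add]
  rfl

lemma le_of_lexKey_le {f : (Fin r → ℝ) →ₗ[ℝ] ℝ} {x y : Fin r → ℝ}
    (h : lexKey f x ≤ lexKey f y) : f x ≤ f y := Prod.Lex.monotone_fst _ _ h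

/-- If a linear functional vanishes at a null exponent `c ≠ 0` of a superpotential and is
nonnegative on `½ (d + 𝒲)`, then it is nonnegative at all exponents. Otherwise the smallest
exponent `a` is null and not proportional to `c`. Let `b` be the smallest exponent with
`J(a, b) ≠ 0`. The sum `a + b` does not lie in `d + 𝒲`, and it has no other representation as
the sum of two non-orthogonal exponents, since exponents between `a` and `b` are orthogonal to
`a` while `J(a, a + b) ≠ 0`. -/
lemma nonneg_of_nonneg_halfWeights (hd : ∀ i, 0 < S.d i) {C : Finset (Fin r → ℝ)}
    {F : (Fin r → ℝ) → ℝ} (hF : ∀ c ∈ C, F c ≠ 0)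
    (hu : S.IsSuperpotential (expSum C F)) {c : Fin r → ℝ} (hc : c ∈ C) (hc0 : c ≠ 0)
    (hnull : S.J c c = 0) (f : (Fin r → ℝ) →ₗ[ℝ] ℝ) (hfc : f c = 0)
    (hf : ∀ x ∈ S.halfWeights, 0 ≤ f x) : ∀ x ∈ C, 0 ≤ f x := by
  by_contra! hcon
  obtain ⟨x₀, hx₀, hfx₀⟩ := hcon
  obtain ⟨a, ha, hamin⟩ := C.exists_min_image (lexKey f) ⟨c, hc⟩
  have hfa : f a < 0 := (le_of_lexKey_le (hamin x₀ hx₀)).trans_lt hfx₀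
  have hzero : ∀ x, f x < 0 →
      ∑ z ∈ C ×ˢ C with z.1 + z.2 = x, S.J z.1 z.2 * F z.1 * F z.2 = 0 := by
    intro x hx
    rw [hu.sum_eq_weightCoeff]
    by_contra h
    have := hf _ ((S.weightCoeff_ne_zero_iff x).1 h)
    rw [map_smul, smul_eq_mul] at this
    linarith
  have hle : ∀ {x y x' y' : Fin r → ℝ}, x + y = x' + y' → lexKey f x' ≤ lexKey f x →
      lexKey f y ≤ lexKey f y' := by
    intro x y x' y' h hx
    have h' : lexKey f x + lexKey f y = lexKey f x' + lexKey f y' := by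
      rw [← lexKey_add, ← lexKey_add, h]
    by_contra! hlt
    exact absurd h' (add_lt_add_of_le_of_lt hx hlt).ne'
  have haa : S.J a a = 0 := by
    have h := hzero (a + a) (by rw [map_add]; linarith)
    rw [Finset.sum_eq_single (a, a)] at h
    · simpa [hF a ha] using h
    · rintro ⟨x, y⟩ hz hne
      simp only [Finset.mem_filter, Finset.mem_product] at hz
      obtain ⟨⟨hx, hy⟩, hxy⟩ := hz
      refine absurd ?_ hne
      have hya := lexKey_injective f (le_antisymm (hle hxy (hamin x hx)) (hamin y hy))
      rw [hya] at hxy ⊢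
      rw [add_right_cancel hxy]
    · intro h
      simp [ha] at h
  have hac : S.J a c ≠ 0 := by
    intro h
    obtain ⟨t, rfl⟩ := S.exists_eq_smul_of_null hd hc0 hnull haa h
    rw [map_smul, hfc, smul_zero] at hfa
    exact hfa.false
  obtain ⟨b, hb, hbmin⟩ := (C.filter fun x => S.J a x ≠ 0).exists_min_image (lexKey f)
    ⟨c, by simp [hc, hac]⟩
  simp only [Finset.mem_filter, and_imp] at hb hbmin
  obtain ⟨hbC, hab⟩ := hb
  have hfb : f b ≤ 0 := hfc ▸ le_of_lexKey_le (hbmin c hc hac)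
  have hne : a ≠ b := by
    rintro rfl
    exact hab haa
  have h := hzero (a + b) (by rw [map_add]; linarith)
  rw [← Finset.sum_subset (s₁ := {(a, b), (b, a)})] at h
  · rw [Finset.sum_pair (by simp [hne])] at h
    simp only [S.J_comm b a] at h
    have : S.J a b * F a * F b ≠ 0 := mul_ne_zero (mul_ne_zero hab (hF a ha)) (hF b hbC)
    apply this
    linarith
  · intro z hz
    simp only [Finset.mem_insert, Finset.mem_singleton] at hz
    rcases hz with rfl | rfl
    · simp [ha, hbC]
    · simp [ha, hbC, add_comm]
  · rintro ⟨x, y⟩ hz hz'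
    simp only [Finset.mem_filter, Finset.mem_product, Finset.mem_insert, Finset.mem_singleton,
      not_or, Prod.mk.injEq, not_and] at hz hz'
    obtain ⟨⟨hx, hy⟩, hxy⟩ := hz
    exfalso
    have orth : ∀ {u v : Fin r → ℝ}, u ∈ C → v ∈ C → u + v = a + b → v ≠ a → S.J a u = 0 := by
      intro u v hu hv huv hva
      by_contra h0
      have h1 := hbmin u hu h0
      have h2 := hle (huv.trans (add_comm a b)) h1
      exact hva (lexKey_injective f (le_antisymm h2 (hamin v hv)))
    have hya : y ≠ a := fun h => hz'.2 (by rw [h, add_comm] at hxy; exact add_left_cancel hxy) h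
    have hxa : x ≠ a := fun h => hz'.1 h (by rw [h] at hxy; exact add_left_cancel hxy)
    have e1 := orth hx hy hxy hya
    have e2 := orth hy hx ((add_comm y x).trans hxy) hxa
    have e3 : S.J a (x + y) = S.J a (a + b) := by rw [hxy]
    rw [J_add_right, J_add_right, e1, e2, haa] at e3
    exact hab (by linarith)

/-- An exponent in the zero set of the functional of `nonneg_of_nonneg_halfWeights` lies in
every subspace that contains `c` and the part of `½ (d + 𝒲)` in this zero set. -/
lemma mem_of_pos_halfWeights (hd : ∀ i, 0 < S.d i) {C : Finset (Fin r → ℝ)}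
    {F : (Fin r → ℝ) → ℝ} (hF : ∀ c ∈ C, F c ≠ 0)
    (hu : S.IsSuperpotential (expSum C F)) {c : Fin r → ℝ} (hc : c ∈ C) (hc0 : c ≠ 0)
    (hnull : S.J c c = 0) (f : (Fin r → ℝ) →ₗ[ℝ] ℝ) (U : Submodule ℝ (Fin r → ℝ))
    (hcU : c ∈ U) (hfU : ∀ x ∈ U, f x = 0) (hf : ∀ x ∈ S.halfWeights, x ∈ U ∨ 0 < f x) :
    ∀ x ∈ C, f x = 0 → x ∈ U := by
  intro x hx hfx
  by_contra hxU
  obtain ⟨g, hgx, hg⟩ := Submodule.exists_le_ker_of_notMem hxU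
  -- Perturb `f` by a small multiple of a functional that vanishes on `U` but not at `x`.
  have hev : ∀ᶠ ε : ℝ in nhdsWithin 0 (Set.Ioi 0), ∀ y ∈ S.halfWeights,
      0 ≤ f y - ε * (g x * g y) := by
    rw [Filter.eventually_all_finite S.halfWeights_finite]
    intro y hy
    rcases hf y hy with h | h
    · refine Filter.Eventually.of_forall fun ε => ?_
      rw [hfU y h, show g y = 0 from hg h]
      simp
    · have ht : Filter.Tendsto (fun ε : ℝ => f y - ε * (g x * g y)) (nhds 0) (nhds (f y)) := by
        have : Continuous fun ε : ℝ => f y - ε * (g x * g y) := by fun_prop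
        simpa using this.tendsto 0
      exact ((ht.eventually_const_lt h).mono fun ε h => h.le).filter_mono nhdsWithin_le_nhds
  obtain ⟨ε, hε, hε0⟩ := (hev.and self_mem_nhdsWithin).exists
  have hε0' : (0 : ℝ) < ε := hε0
  have h := S.nonneg_of_nonneg_halfWeights hd hF hu hc hc0 hnull (f - (ε * g x) • g)
    (by simp [hfU c hcU, show g c = 0 from hg hcU])
    (fun y hy => by simpa [mul_assoc] using hε y hy) x hx
  simp only [LinearMap.sub_apply, LinearMap.smul_apply, hfx, smul_eq_mul] at h
  have : 0 < g x * g x := mul_self_pos.2 hgx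
  nlinarith

/-- An edge of the polytope is cut out by a linear functional that vanishes on the plane
spanned by the edge and is positive at all other points of `½ (d + 𝒲)`. -/
lemma exists_supporting_functional (hn : 1 < S.n) {V W : Fin r → ℝ}
    (hV : V ∈ S.halfWeights) (hW : W ∈ S.halfWeights)
    (hE : IsExtreme ℝ S.polytope (segment ℝ V W))
    (hL : (line[ℝ, V, W] : Set (Fin r → ℝ)) ∩ S.polytope ⊆ segment ℝ V W) :
    ∃ f : (Fin r → ℝ) →ₗ[ℝ] ℝ, (∀ x ∈ Submodule.span ℝ {V, W}, f x = 0) ∧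
      ∀ x ∈ S.halfWeights, x ∉ segment ℝ V W → 0 < f x := by
  set U := Submodule.span ℝ {V, W} with hU
  set B := convexHull ℝ (S.halfWeights \ segment ℝ V W) with hB
  have hsub : B ⊆ S.polytope \ segment ℝ V W := by
    refine convexHull_min (fun x hx => ⟨subset_convexHull ℝ _ hx.1, hx.2⟩) ?_
    exact hE.convex_sdiff (convex_convexHull ℝ _)
  have hsumP : ∀ x ∈ S.polytope, ∑ i, x i = (S.n - 1) / 2 := by
    have hlin : IsLinearMap ℝ fun x : Fin r → ℝ => ∑ i, x i :=
      ⟨fun x y => by simp [Finset.sum_add_distrib], fun t x => by simp [Finset.mul_sum]⟩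
    intro x hx
    exact convexHull_min (fun y hy => S.sum_of_mem_halfWeights hy)
      (convex_hyperplane hlin ((S.n - 1) / 2)) hx
  have hdisj : Disjoint B (U : Set (Fin r → ℝ)) := by
    rw [Set.disjoint_left]
    intro x hxB hxU
    obtain ⟨hxP, hxs⟩ := hsub hxB
    apply hxs
    refine hL ⟨?_, hxP⟩
    obtain ⟨s, t, rfl⟩ := Submodule.mem_span_pair.1 hxU
    have h := hsumP _ hxP
    simp only [Pi.add_apply, Pi.smul_apply, smul_eq_mul, Finset.sum_add_distrib,
      ← Finset.mul_sum, S.sum_of_mem_halfWeights hV, S.sum_of_mem_halfWeights hW] at h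
    have hst : s + t = 1 := by
      have : (S.n - 1) / 2 ≠ 0 := by linarith
      apply mul_right_cancel₀ this
      linarith
    rw [show s • V + t • W = AffineMap.lineMap V W t by
      rw [AffineMap.lineMap_apply_module, ← hst]; simp]
    exact AffineMap.lineMap_mem_affineSpan_pair t V W
  have hBc : IsCompact B :=
    (S.halfWeights_finite.subset Set.sdiff_subset).isCompact_convexHull (𝕜 := ℝ)
  obtain ⟨g, u, v, hgB, huv, hgU⟩ := geometric_hahn_banach_compact_closed
    (convex_convexHull ℝ _) hBc U.convex U.closed_of_finiteDimensional hdisj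
  have hv : v < 0 := by simpa using hgU 0 U.zero_mem
  have hg0 : ∀ x ∈ U, g x = 0 := by
    intro x hx
    by_contra h
    have := hgU ((v / g x) • x) (U.smul_mem _ hx)
    rw [map_smul, smul_eq_mul, div_mul_cancel₀ _ h] at this
    exact this.false
  refine ⟨-g.toLinearMap, fun x hx => by simp [hg0 x hx], fun x hx hxs => ?_⟩
  have := hgB x (subset_convexHull ℝ _ ⟨hx, hxs⟩)
  simp only [LinearMap.neg_apply, ContinuousLinearMap.coe_coe]
  linarith

end Support

end Superpotential.ScalarCurvatureData

namespace Superpotential.ScalarCurvatureData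

/-! ### Restriction to the line through the edge -/

section Edge

variable {r : ℕ} (S : ScalarCurvatureData r)

/-- The sum of the coordinates as a linear functional. -/
def coordSum : (Fin r → ℝ) →ₗ[ℝ] ℝ where
  toFun x := ∑ i, x i
  map_add' x y := by simp [Finset.sum_add_distrib]
  map_smul' t x := by simp [Finset.mul_sum]

lemma coordSum_apply (x : Fin r → ℝ) : coordSum x = ∑ i, x i := rfl

/-- The edge lies on a ray from `c`, since it is on the far side of a hyperplane separating `c`
from the polytope. -/
lemma _root_.Superpotential.IsTypeTwoVertex.exists_param {S : ScalarCurvatureData r}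
    {h : (Fin r → ℝ) →ₗ[ℝ] ℝ} {b : ℝ} {c ξ V W : Fin r → ℝ}
    (H : IsTypeTwoVertex S h b c ξ V W) (hnull : S.J c c = 0) :
    ∃ T : ℝ, 1 < T ∧ W = c + T • (V - c) ∧ S.J c V ≠ 0 := by
  have hξ : h ξ = b := (extremePoints_subset H.vertex).1
  have hcb : h c < b := H.separates.1
  have hpar : ∀ x ∈ segment ℝ V W, ∃ t : ℝ, 0 < t ∧ x = c + t • (ξ - c) := by
    intro x hx
    rw [← H.line_inter] at hx
    obtain ⟨hxl, hxP⟩ := hx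
    have hdir := AffineSubspace.vsub_mem_direction hxl (left_mem_affineSpan_pair ℝ c ξ)
    rw [direction_affineSpan, mem_vectorSpan_pair_rev] at hdir
    obtain ⟨t, ht⟩ := hdir
    have hx : x = c + t • (ξ - c) := eq_add_of_sub_eq' ht.symm
    have h1 := H.separates.2 _ hxP
    rw [hx, map_add, map_smul, map_sub, hξ, smul_eq_mul] at h1
    refine ⟨t, ?_, hx⟩
    by_contra! ht
    nlinarith
  obtain ⟨v, hv0, hv⟩ := hpar V (left_mem_segment ℝ V W)
  obtain ⟨w, hw0, hw⟩ := hpar W (right_mem_segment ℝ V W)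
  have hnear := H.nearer
  rw [hv, hw] at hnear
  simp only [dist_self_add_right, norm_smul, Real.norm_eq_abs, abs_of_pos hv0,
    abs_of_pos hw0] at hnear
  have hvw : v < w := lt_of_mul_lt_mul_right hnear (norm_nonneg _)
  refine ⟨w / v, (one_lt_div hv0).2 hvw, ?_, ?_⟩
  · rw [hv, add_sub_cancel_left, smul_smul, div_mul_cancel₀ _ hv0.ne', hw]
  · rw [hv, J_add_right, J_smul_right, J_sub_right, hnull, sub_zero, zero_add]
    exact mul_ne_zero hv0.ne' H.not_orthogonal

lemma mem_extremePoints_segment_left {E : Type*} [AddCommGroup E] [Module ℝ E] (V W : E) :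
    V ∈ (segment ℝ V W).extremePoints ℝ := by
  refine mem_extremePoints_iff_left.2 ⟨left_mem_segment ℝ V W, ?_⟩
  intro x₁ hx₁ x₂ hx₂ hV
  by_cases hVW : W = V
  · subst hVW
    simpa using hx₁
  rw [segment_eq_image'] at hx₁ hx₂
  obtain ⟨s, ⟨hs0, _⟩, rfl⟩ := hx₁
  obtain ⟨t, ⟨ht0, _⟩, rfl⟩ := hx₂
  obtain ⟨m, k, hm, hk, hmk, hsum⟩ := hV
  have hz : (m * s + k * t) • (W - V) = 0 := by
    have hsum' : m • (V + s • (W - V)) + k • (V + t • (W - V)) = (m + k) • V := by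
      rw [hsum, hmk, one_smul]
    rw [← sub_eq_zero] at hsum'
    rw [← hsum']
    module
  rcases smul_eq_zero.1 hz with h | h
  · have : s = 0 := by nlinarith [mul_nonneg hm.le hs0, mul_nonneg hk.le ht0]
    simp [this]
  · exact absurd (sub_eq_zero.1 h) hVW

lemma _root_.Superpotential.IsTypeTwoVertex.mem_halfWeights {S : ScalarCurvatureData r}
    {h : (Fin r → ℝ) →ₗ[ℝ] ℝ} {b : ℝ} {c ξ V W : Fin r → ℝ}
    (H : IsTypeTwoVertex S h b c ξ V W) : V ∈ S.halfWeights ∧ W ∈ S.halfWeights := by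
  refine ⟨extremePoints_convexHull_subset (𝕜 := ℝ)
    (H.isEdge.extremePoints_subset_extremePoints (mem_extremePoints_segment_left V W)),
    extremePoints_convexHull_subset (𝕜 := ℝ)
    (H.isEdge.extremePoints_subset_extremePoints ?_)⟩
  rw [segment_symm]
  exact mem_extremePoints_segment_left W V

/-- In a Lorentzian plane containing the null vector `c` the form `J` is, up to a factor, the
symmetrised product of two linear functionals: those pairing with `c` and with the other null
direction. -/
lemma J_eq_of_plane {c V : Fin r → ℝ} (hnull : S.J c c = 0) (hcV : S.J c V ≠ 0) {x y : Fin r → ℝ}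
    (hx : ∃ m k : ℝ, x = m • c + k • (V - c)) (hy : ∃ m k : ℝ, y = m • c + k • (V - c)) :
    S.J x y * S.J c V =
      S.J (V - (S.J V V / (2 * S.J c V)) • c) x * S.J c y +
        S.J (V - (S.J V V / (2 * S.J c V)) • c) y * S.J c x := by
  obtain ⟨m, k, rfl⟩ := hx
  obtain ⟨m', k', rfl⟩ := hy
  simp only [J_add_left, J_add_right, J_sub_left, J_sub_right, J_smul_left, J_smul_right, hnull,
    S.J_comm V c]
  field_simp
  ring

/-- The part of the coefficient equations on the face of the exponents cut out by a
supporting functional `f`, written as a product of two exponential sums. -/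
lemma sum_mul_ne_zero_iff {C C₀ : Finset (Fin r → ℝ)} {F : (Fin r → ℝ) → ℝ}
    (hu : S.IsSuperpotential (expSum C F)) {c V : Fin r → ℝ} (hnull : S.J c c = 0)
    (hcV : S.J c V ≠ 0) (f : (Fin r → ℝ) →ₗ[ℝ] ℝ) (hf : ∀ x ∈ C, 0 ≤ f x)
    (hC₀ : ∀ x, x ∈ C₀ ↔ x ∈ C ∧ f x = 0)
    (hplane : ∀ x ∈ C₀, ∃ m k : ℝ, x = m • c + k • (V - c)) {x : Fin r → ℝ} (hx : f x = 0) :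
    ∑ z ∈ C₀ ×ˢ C₀ with z.1 + z.2 = x,
      (S.J (V - (S.J V V / (2 * S.J c V)) • c) z.1 * F z.1) * (S.J c z.2 * F z.2) ≠ 0 ↔
      (1 / 2 : ℝ) • x ∈ S.halfWeights := by
  set N := V - (S.J V V / (2 * S.J c V)) • c
  have hswap : ∑ z ∈ C₀ ×ˢ C₀ with z.1 + z.2 = x, (S.J N z.2 * F z.2) * (S.J c z.1 * F z.1) =
      ∑ z ∈ C₀ ×ˢ C₀ with z.1 + z.2 = x, (S.J N z.1 * F z.1) * (S.J c z.2 * F z.2) := by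
    refine Finset.sum_nbij' Prod.swap Prod.swap ?_ ?_ ?_ ?_ ?_
    · simp +contextual [add_comm]
    · simp +contextual [add_comm]
    · simp
    · simp
    · simp
  have hface : ∑ z ∈ C₀ ×ˢ C₀ with z.1 + z.2 = x, S.J z.1 z.2 * F z.1 * F z.2 =
      S.weightCoeff (x - S.dVec) := by
    rw [← hu.sum_eq_weightCoeff]
    refine Finset.sum_congr ?_ fun _ _ => rfl
    ext ⟨y, z⟩
    simp only [Finset.mem_filter, Finset.mem_product, hC₀]
    refine ⟨fun h => ⟨⟨h.1.1.1, h.1.2.1⟩, h.2⟩, fun h => ?_⟩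
    have h1 : f y + f z = 0 := by rw [← map_add, h.2, hx]
    have h2 := hf y h.1.1
    have h3 := hf z h.1.2
    exact ⟨⟨⟨h.1.1, by linarith⟩, ⟨h.1.2, by linarith⟩⟩, h.2⟩
  have hmul : S.weightCoeff (x - S.dVec) * S.J c V =
      2 * ∑ z ∈ C₀ ×ˢ C₀ with z.1 + z.2 = x, (S.J N z.1 * F z.1) * (S.J c z.2 * F z.2) := by
    rw [two_mul]
    nth_rewrite 1 [← hswap]
    rw [← hface, Finset.sum_mul, ← Finset.sum_add_distrib]
    refine Finset.sum_congr rfl fun z hz => ?_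
    simp only [Finset.mem_filter, Finset.mem_product] at hz
    have := S.J_eq_of_plane hnull hcV (hplane _ hz.1.1) (hplane _ hz.1.2)
    linear_combination F z.1 * F z.2 * this
  rw [← S.weightCoeff_ne_zero_iff]
  constructor
  · intro h h0
    rw [h0, zero_mul] at hmul
    exact h (by linarith)
  · intro h h0
    rw [h0, mul_zero] at hmul
    exact h ((mul_eq_zero.1 hmul).resolve_right hcV)

/-- If `2 κ` is the only level of a linear functional on the support of a product of two
exponential sums, then each factor is supported on a single level. -/
lemma eq_of_level {C₀ : Finset (Fin r → ℝ)} {P Q : (Fin r → ℝ) → ℝ}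
    (σ : (Fin r → ℝ) →ₗ[ℝ] ℝ) {κ : ℝ}
    (hlev : ∀ x, ∑ z ∈ C₀ ×ˢ C₀ with z.1 + z.2 = x, P z.1 * Q z.2 ≠ 0 →
      (∃ y ∈ C₀, ∃ z ∈ C₀, y + z = x) → σ x = 2 * κ)
    {c : Fin r → ℝ} (hc : c ∈ C₀) (hPc : P c ≠ 0) (hσc : σ c = κ)
    (hQ : ∃ y ∈ C₀, Q y ≠ 0) {x : Fin r → ℝ} (hx : x ∈ C₀) (hPQ : P x ≠ 0 ∨ Q x ≠ 0) :
    σ x = κ := by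
  have key : ∀ g : (Fin r → ℝ) →ₗ[ℝ] ℝ, ∃ a ∈ C₀, ∃ b ∈ C₀, P a ≠ 0 ∧ Q b ≠ 0 ∧
      (∀ y ∈ C₀, P y ≠ 0 → g a ≤ g y) ∧ (∀ y ∈ C₀, Q y ≠ 0 → g b ≤ g y) ∧
      σ a + σ b = 2 * κ := by
    intro g
    obtain ⟨a, ha, b, hb, ham, hbm, hu⟩ := exists_min_pair_unique (lexKey g)
      (lexKey_injective g) (lexKey_add g)
      (S := C₀.filter (fun t => P t ≠ 0)) (T := C₀.filter (fun t => Q t ≠ 0))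
      ⟨c, by simp [hc, hPc]⟩ (by obtain ⟨t, h1, h2⟩ := hQ; exact ⟨t, by simp [h1, h2]⟩)
    simp only [Finset.mem_filter, and_imp] at ha hb ham hbm hu
    refine ⟨a, ha.1, b, hb.1, ha.2, hb.2, fun y hy hPy => le_of_lexKey_le (ham y hy hPy),
      fun y hy hQy => le_of_lexKey_le (hbm y hy hQy), ?_⟩
    rw [← map_add]
    exact hlev _ (sum_mul_ne_zero_of_unique ha.1 hb.1 ha.2 hb.2
      fun x hx y hy hPx hQy h => hu x hx hPx y hy hQy h) ⟨a, ha.1, b, hb.1, rfl⟩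
  obtain ⟨a, ha, b, hb, hPa, hQb, ham, hbm, hab⟩ := key σ
  obtain ⟨a', ha', b', hb', hPa', hQb', ham', hbm', hab'⟩ := key (-σ)
  simp only [LinearMap.neg_apply, neg_le_neg_iff] at ham' hbm'
  have h1 := ham c hc hPc
  have h2 := ham' c hc hPc
  have h3 := hbm b' hb' hQb'
  rcases hPQ with h | h
  · have h4 := ham x hx h
    have h5 := ham' x hx h
    linarith
  · have h4 := hbm x hx h
    have h5 := hbm' x hx h
    linarith

/-- Restricted to the line through the edge, the coefficient equations say that the product of
two exponential sums in one variable has exactly three terms. The parameter of the line is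
chosen such that `c`, `V` and `W` are at `0`, `1` and `T`. -/
lemma exists_hasThreeTermProduct (hd : ∀ i, 0 < S.d i) (hn : 1 < S.n)
    {C : Finset (Fin r → ℝ)} {F : (Fin r → ℝ) → ℝ} (hF : ∀ c ∈ C, F c ≠ 0)
    (hu : S.IsSuperpotential (expSum C F)) {c : Fin r → ℝ} (hc : c ∈ C)
    (hnull : S.J c c = 0) {V W : Fin r → ℝ} {T : ℝ} (hT : 1 < T)
    (hW : W = c + T • (V - c)) (hcV : S.J c V ≠ 0)
    (hVH : V ∈ S.halfWeights) (hWH : W ∈ S.halfWeights)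
    (hmid : midpoint ℝ V W ∈ S.halfWeights)
    (hE : IsExtreme ℝ S.polytope (segment ℝ V W))
    (hL : (line[ℝ, V, W] : Set (Fin r → ℝ)) ∩ S.polytope ⊆ segment ℝ V W) :
    ∃ A : Finset ℝ, (∀ t, t ∈ A ↔ c + t • (V - c) ∈ C) ∧
      HasThreeTermProduct A
        (fun t => S.J (V - (S.J V V / (2 * S.J c V)) • c) (c + t • (V - c)) *
          F (c + t • (V - c)))
        (fun t => S.J c (c + t • (V - c)) * F (c + t • (V - c))) 1 T := by
  set N := V - (S.J V V / (2 * S.J c V)) • c with hN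
  set ι : ℝ → Fin r → ℝ := fun t => c + t • (V - c) with hι
  have hc0 : c ≠ 0 := by
    rintro rfl
    exact hcV (by simp [J])
  have hVc : V - c ≠ 0 := by
    intro h
    rw [sub_eq_zero] at h
    exact hcV (h ▸ hnull)
  have hVW : V ≠ W := by
    intro h
    have h' : (T - 1) • (V - c) = 0 := by
      rw [sub_smul, one_smul, sub_eq_zero, ← add_right_inj c, ← hW, ← h]
      abel
    rcases smul_eq_zero.1 h' with h | h
    · linarith
    · exact hVc h
  have hιinj : Function.Injective ι := by
    intro s t hst
    exact smul_left_injective ℝ hVc (add_left_cancel hst)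
  obtain ⟨f, hfU, hfpos⟩ := S.exists_supporting_functional hn hVH hWH hE hL
  have hfV : f V = 0 := hfU V (Submodule.subset_span (by simp))
  have hfW : f W = 0 := hfU W (Submodule.subset_span (by simp))
  have hcU : c ∈ Submodule.span ℝ {V, W} := by
    refine Submodule.mem_span_pair.2 ⟨T / (T - 1), -1 / (T - 1), ?_⟩
    have hT' : T - 1 ≠ 0 := by linarith
    rw [hW]
    match_scalars <;> field_simp <;> ring
  have hfc : f c = 0 := hfU c hcU
  have hsegU : segment ℝ V W ⊆ Submodule.span ℝ {V, W} :=
    (Submodule.span ℝ {V, W}).convex.segment_subset (Submodule.subset_span (by simp))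
      (Submodule.subset_span (by simp))
  have hfH : ∀ x ∈ S.halfWeights, x ∈ Submodule.span ℝ {V, W} ∨ 0 < f x := by
    intro x hx
    by_cases hxs : x ∈ segment ℝ V W
    · exact Or.inl (hsegU hxs)
    · exact Or.inr (hfpos x hx hxs)
  have hfC := S.nonneg_of_nonneg_halfWeights hd hF hu hc hc0 hnull f hfc
    fun x hx => (hfH x hx).elim (fun h => (hfU x h).ge) le_of_lt
  have hCU := S.mem_of_pos_halfWeights hd hF hu hc hc0 hnull f _ hcU hfU hfH
  set C₀ := C.filter fun x => f x = 0 with hC₀def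
  have hC₀ : ∀ x, x ∈ C₀ ↔ x ∈ C ∧ f x = 0 := fun x => Finset.mem_filter
  have hplane : ∀ x ∈ C₀, ∃ m k : ℝ, x = m • c + k • (V - c) := by
    intro x hx
    obtain ⟨s, t, rfl⟩ := Submodule.mem_span_pair.1 (hCU x ((hC₀ x).1 hx).1 ((hC₀ x).1 hx).2)
    refine ⟨s + t, s + t * T, ?_⟩
    rw [hW]
    module
  have hprod : ∀ {x : Fin r → ℝ}, f x = 0 → _ := fun {x} hx =>
    S.sum_mul_ne_zero_iff (F := F) hu hnull hcV f hfC hC₀ hplane hx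
  rw [← hN] at hprod
  set P : (Fin r → ℝ) → ℝ := fun x => S.J N x * F x with hP
  set Q : (Fin r → ℝ) → ℝ := fun x => S.J c x * F x with hQ
  -- All terms of the two factors lie in the hyperplane that contains `½ (d + 𝒲)`.
  have hσV : coordSum V = (S.n - 1) / 2 := S.sum_of_mem_halfWeights hVH
  have hσW : coordSum W = (S.n - 1) / 2 := S.sum_of_mem_halfWeights hWH
  have hσc : coordSum c = (S.n - 1) / 2 := by
    rw [hW, map_add, map_smul, map_sub, hσV, smul_eq_mul] at hσW
    have : (T - 1) * (coordSum c - (S.n - 1) / 2) = 0 := by linarith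
    rcases mul_eq_zero.1 this with h | h <;> linarith
  have hNc : S.J N c = S.J c V := by
    simp [hN, J_sub_left, J_smul_left, hnull, S.J_comm V c]
  have hcC₀ : c ∈ C₀ := (hC₀ c).2 ⟨hc, hfc⟩
  have hfC₀ : ∀ {y z : Fin r → ℝ}, y ∈ C₀ → z ∈ C₀ → f (y + z) = 0 := by
    intro y z hy hz
    rw [map_add, ((hC₀ y).1 hy).2, ((hC₀ z).1 hz).2, add_zero]
  have hlevel : ∀ x ∈ C₀, P x ≠ 0 ∨ Q x ≠ 0 → coordSum x = (S.n - 1) / 2 := by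
    intro x hx hPQ
    refine eq_of_level (C₀ := C₀) (P := P) (Q := Q) coordSum ?_ hcC₀
      (mul_ne_zero (hNc ▸ hcV) (hF c hc)) hσc ?_ hx hPQ
    · rintro x hne ⟨y, hy, z, hz, rfl⟩
      have := S.sum_of_mem_halfWeights ((hprod (hfC₀ hy hz)).1 hne)
      rw [← coordSum_apply, map_smul, smul_eq_mul] at this
      linarith
    · have h : (1 / 2 : ℝ) • ((2 : ℝ) • V) ∈ S.halfWeights := by
        rwa [smul_smul, one_div_mul_cancel two_ne_zero, one_smul]
      obtain ⟨_, _, y, hy, _, hQy, _⟩ := exists_of_sum_mul_ne_zero (p := P) (q := Q)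
        ((hprod (by rw [map_smul, hfV, smul_zero])).2 h)
      exact ⟨y, hy, hQy⟩
  have hline : ∀ x ∈ C₀, P x ≠ 0 ∨ Q x ≠ 0 → ∃ t, ι t = x := by
    intro x hx hPQ
    have h := hlevel x hx hPQ
    obtain ⟨m, k, rfl⟩ := hplane x hx
    simp only [map_add, map_smul, map_sub, hσc, hσV, smul_eq_mul, sub_self, mul_zero,
      add_zero] at h
    have hm : m = 1 := by
      have : (S.n - 1) / 2 ≠ 0 := by linarith
      exact mul_right_cancel₀ this (by linarith)
    exact ⟨k, by rw [hm, one_smul]⟩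
  refine ⟨C.preimage ι hιinj.injOn, fun t => Finset.mem_preimage, fun τ => ?_⟩
  have hfι : ∀ t, f (ι t) = 0 := fun t => by
    simp [hι, hfc, hfV]
  have hsum : ∑ z ∈ (C.preimage ι hιinj.injOn) ×ˢ (C.preimage ι hιinj.injOn) with
        z.1 + z.2 = τ, P (ι z.1) * Q (ι z.2) =
      ∑ z ∈ C₀ ×ˢ C₀ with z.1 + z.2 = (2 : ℝ) • ι (τ / 2), P z.1 * Q z.2 := by
    have hadd : ∀ s t : ℝ, ι s + ι t = (2 : ℝ) • ι ((s + t) / 2) := fun s t => by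
      simp only [hι]
      module
    refine Finset.sum_of_injOn (Prod.map ι ι) (hιinj.prodMap hιinj).injOn ?_ ?_
      (fun _ _ => rfl)
    · rintro ⟨s, t⟩ hz
      simp only [Finset.coe_filter, Finset.mem_product, Finset.mem_preimage,
        Set.mem_ofPred_eq] at hz
      simp only [Finset.coe_filter, Finset.mem_product, Set.mem_ofPred_eq, Prod.map, hC₀, hfι,
        hz.1.1, hz.1.2, true_and, and_true]
      rw [hadd, hz.2]
    · rintro ⟨y, z⟩ hz hnot
      simp only [Finset.mem_filter, Finset.mem_product] at hz
      by_contra h0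
      obtain ⟨s, rfl⟩ := hline y hz.1.1 (Or.inl (left_ne_zero_of_mul h0))
      obtain ⟨t, rfl⟩ := hline z hz.1.2 (Or.inr (right_ne_zero_of_mul h0))
      refine hnot ⟨(s, t), ?_, rfl⟩
      simp only [Finset.coe_filter, Finset.mem_product, Finset.mem_preimage,
        Set.mem_ofPred_eq]
      refine ⟨⟨((hC₀ _).1 hz.1.1).1, ((hC₀ _).1 hz.1.2).1⟩, ?_⟩
      have h := hz.2
      rw [hadd] at h
      have := hιinj (smul_right_injective (Fin r → ℝ) (two_ne_zero (α := ℝ)) h)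
      linarith
  have hV1 : V = ι 1 := by simp [hι]
  have hWT : W = ι T := hW
  have hιt : ∀ t : ℝ, V + t • (W - V) = ι (1 + t * (T - 1)) := fun t => by
    rw [hW]
    simp only [hι]
    module
  have hM : midpoint ℝ V W = ι ((1 + T) / 2) := by
    rw [midpoint_eq_smul_add, hW, invOf_eq_inv]
    simp only [hι]
    module
  change ∑ z ∈ (C.preimage ι hιinj.injOn) ×ˢ (C.preimage ι hιinj.injOn) with
        z.1 + z.2 = τ, P (ι z.1) * Q (ι z.2) ≠ 0 ↔ _
  rw [hsum, hprod (by rw [map_smul, hfι, smul_zero]), smul_smul,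
    one_div_mul_cancel two_ne_zero, one_smul]
  constructor
  · intro hH
    have hseg : ι (τ / 2) ∈ segment ℝ V W := by
      by_contra h
      exact (hfpos _ hH h).ne' (hfι _)
    rw [segment_eq_image'] at hseg
    obtain ⟨t, ⟨ht0, ht1⟩, ht⟩ := hseg
    have ht' : V + t • (W - V) = ι (τ / 2) := ht
    have hτ : 1 + t * (T - 1) = τ / 2 := hιinj ((hιt t).symm.trans ht')
    rcases ht0.eq_or_lt with h0 | h0
    · left
      rw [← h0] at hτ
      linarith
    rcases ht1.eq_or_lt with h1 | h1
    · right; right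
      rw [h1] at hτ
      linarith
    · right; left
      have := S.eq_half_of_mem_halfWeights hVW hVH hWH hmid (ht' ▸ hH) h0 h1
      rw [this] at hτ
      linarith
  · rintro (h | h | h)
    · rwa [h, mul_div_cancel_left₀ _ two_ne_zero, ← hV1]
    · rwa [h, ← hM]
    · rwa [h, mul_div_cancel_left₀ _ two_ne_zero, ← hWT]

/-- The exponents on the line through the edge: with the parameter of
`exists_hasThreeTermProduct`, the second null point of the line is the exponent at `T + 1`, so
that the line carries an affine reflection which exchanges `V` and `W` and preserves `J`. -/
lemma edge_rigidity (hd : ∀ i, 0 < S.d i) (hn : 1 < S.n)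
    {C : Finset (Fin r → ℝ)} {F : (Fin r → ℝ) → ℝ} (hF : ∀ c ∈ C, F c ≠ 0)
    (hu : S.IsSuperpotential (expSum C F)) {c : Fin r → ℝ} (hc : c ∈ C)
    (hnull : S.J c c = 0) {V W : Fin r → ℝ} {T : ℝ} (hT : 1 < T)
    (hW : W = c + T • (V - c)) (hcV : S.J c V ≠ 0)
    (hVH : V ∈ S.halfWeights) (hWH : W ∈ S.halfWeights)
    (hmid : midpoint ℝ V W ∈ S.halfWeights)
    (hE : IsExtreme ℝ S.polytope (segment ℝ V W))
    (hL : (line[ℝ, V, W] : Set (Fin r → ℝ)) ∩ S.polytope ⊆ segment ℝ V W) :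
    W ∉ C ∧ c + (1 + T) • (V - c) ∈ C ∧ 3 ≤ T ∧ S.J V V = S.J W W := by
  obtain ⟨A, hA, hR⟩ := S.exists_hasThreeTermProduct hd hn hF hu hc hnull hT hW hcV hVH hWH
    hmid hE hL
  set N := V - (S.J V V / (2 * S.J c V)) • c with hN
  have hq : ∀ t, S.J c (c + t • (V - c)) = t * S.J c V := fun t => by
    simp [J_add_right, J_sub_right, J_smul_right, hnull]
  have hp : ∀ t, S.J N (c + t • (V - c)) = S.J c V + t * (S.J V V / 2 - S.J c V) := fun t => by
    simp only [hN, J_add_right, J_sub_right, J_smul_right, J_sub_left, J_smul_left, hnull,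
      S.J_comm V c]
    field_simp
    ring
  have hFA : ∀ t ∈ A, F (c + t • (V - c)) ≠ 0 := fun t ht => hF _ ((hA t).1 ht)
  have h0 : (0 : ℝ) ∈ A := (hA 0).2 (by simpa using hc)
  obtain ⟨h1, h2, h3, h4⟩ := hR.exists_zero one_pos hT h0
    (mul_ne_zero (by rw [hp]; simpa using hcV) (hFA 0 h0))
    (fun t ht => by simp [hq, hFA t ht, hcV])
    (fun s hs t ht hps hpt => by
      have e1 := (mul_eq_zero.1 hps).resolve_right (hFA s hs)
      have e2 := (mul_eq_zero.1 hpt).resolve_right (hFA t ht)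
      rw [hp] at e1 e2
      have e3 : (s - t) * (S.J V V / 2 - S.J c V) = 0 := by linarith
      rcases mul_eq_zero.1 e3 with h | h
      · linarith
      · rw [h, mul_zero, add_zero] at e1
        exact absurd e1 hcV)
  refine ⟨fun h => h3 ((hA T).2 (hW ▸ h)), (hA _).1 h1, by linarith, ?_⟩
  have e := (mul_eq_zero.1 h2).resolve_right (hFA _ h1)
  rw [hp] at e
  have hWW : S.J W W = 2 * T * S.J c V + T ^ 2 * (S.J V V - 2 * S.J c V) := by
    rw [hW]
    simp only [J_add_right, J_sub_right, J_smul_right, J_add_left, J_sub_left, J_smul_left, hnull,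
      S.J_comm V c]
    ring
  rw [hWW]
  linear_combination (2 - 2 * T) * e

/-- On `½ (d + 𝒲)` the form `J` is an affine function of `∑ wᵢ² / dᵢ`, the terms linear in `w`
depending only on the coordinate sum. -/
lemma J_bar (hd : ∀ i, 0 < S.d i) (hn : 1 < S.n) {w : Fin r → ℝ} (hw : ∑ i, w i = -1) :
    S.J (S.bar w) (S.bar w) = (1 - ∑ i, w i ^ 2 / (S.d i : ℝ)) / 4 := by
  have h1 : ∑ i, S.bar w i = (S.n - 1) / 2 := by
    simp only [bar, dVec, n, Pi.smul_apply, Pi.add_apply, smul_eq_mul, ← Finset.mul_sum,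
      Finset.sum_add_distrib, hw]
    ring
  have h2 : ∑ i, S.bar w i * S.bar w i / (S.d i : ℝ) =
      (S.n - 2 + ∑ i, w i ^ 2 / (S.d i : ℝ)) / 4 := by
    have : ∀ i, S.bar w i * S.bar w i / (S.d i : ℝ) =
        ((S.d i : ℝ) + 2 * w i + w i ^ 2 / (S.d i : ℝ)) / 4 := fun i => by
      have : (S.d i : ℝ) ≠ 0 := by exact_mod_cast (hd i).ne'
      simp only [bar, dVec, Pi.smul_apply, Pi.add_apply, smul_eq_mul]
      field_simp
      ring
    simp only [this, ← Finset.sum_div, Finset.sum_add_distrib, ← Finset.mul_sum, hw, n]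
    ring
  rw [J, h1, h2]
  have : S.n - 1 ≠ 0 := by linarith
  field_simp
  ring

lemma J_bar_neg_single (hd : ∀ i, 0 < S.d i) (hn : 1 < S.n) (i : Fin r) :
    S.J (S.bar (-Pi.single i 1)) (S.bar (-Pi.single i 1)) = (1 - 1 / (S.d i : ℝ)) / 4 := by
  rw [S.J_bar hd hn (by simp)]
  congr 2
  rw [Finset.sum_eq_single i (by intro j _ hj; simp [hj]) (by simp)]
  simp

lemma J_bar_single_sub (hd : ∀ i, 0 < S.d i) (hn : 1 < S.n) {i j : Fin r} (hij : i ≠ j) :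
    S.J (S.bar (Pi.single i 1 - 2 • Pi.single j 1)) (S.bar (Pi.single i 1 - 2 • Pi.single j 1)) =
      (1 - (1 / (S.d i : ℝ) + 4 / (S.d j : ℝ))) / 4 := by
  rw [S.J_bar hd hn (by simp [Finset.sum_sub_distrib, ← Finset.mul_sum]; norm_num)]
  congr 2
  rw [Finset.sum_eq_add_of_mem i j (Finset.mem_univ _) (Finset.mem_univ _) hij
    (by intro k _ hk; simp [hk.1, hk.2])]
  simp [hij, hij.symm]
  norm_num

end Edge

end Superpotential.ScalarCurvatureData

/-! ### Type (2) vertices -/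

theorem proposition4p1
    {E : Type*} [NormedAddCommGroup E] [NormedSpace ℝ E] [FiniteDimensional ℝ E]
    [CompleteSpace E]
    {G : Type*} [TopologicalSpace G] [ChartedSpace E G] [Group G] [LieGroup 𝓘(ℝ, E) ∞ G]
    [CompactSpace G] [T2Space G]
    (K : Subgroup G) (hK : IsClosed (K : Set G))
    {r : ℕ} (hr : 2 ≤ r) (D : IsotropyDecomposition E K r)
    (hdim : Module.finrank ℝ (vectorSpan ℝ (convexHull ℝ D.data.weights)) + 1 = r)
    (C : Finset (Fin r → ℝ)) (F : (Fin r → ℝ) → ℝ) (hF : ∀ c ∈ C, F c ≠ 0)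
    (hu : D.data.IsSuperpotential (expSum C F))
    (c : Fin r → ℝ) (hc : c ∈ C) (hnull : D.data.J c c = 0)
    (h : (Fin r → ℝ) →ₗ[ℝ] ℝ) (b : ℝ) (ξ V W : Fin r → ℝ)
    (htype : IsTypeTwoVertex D.data h b c ξ V W)
    (hmid : midpoint ℝ V W ∈ D.data.halfWeights) :
    W ∉ C ∧
    (∃ e ∈ C, Sbtw ℝ V W e) ∧
    (∃ l : ℝ, c = l • V + (1 - l) • W ∧ 1 < l ∧ l ≤ 3 / 2) ∧
    -- the edge is not the one from (1^i, -2^j) to (-1^i)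
    (¬ ∃ i j : Fin r, i ≠ j ∧
      V = D.data.bar (Pi.single i 1 - 2 • Pi.single j 1) ∧
      W = D.data.bar (-Pi.single i 1)) ∧
    -- the edge is not the one from (-1^i) to (1^i, -2^j)
    (¬ ∃ i j : Fin r, i ≠ j ∧
      V = D.data.bar (-Pi.single i 1) ∧
      W = D.data.bar (Pi.single i 1 - 2 • Pi.single j 1)) ∧
    -- an edge from (-2^i, 1^j) to (1^j, -2^k) forces d_i = d_k
    (∀ i j k : Fin r, i ≠ j → j ≠ k → i ≠ k →
      V = D.data.bar (Pi.single j 1 - 2 • Pi.single i 1) →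
      W = D.data.bar (Pi.single j 1 - 2 • Pi.single k 1) →
      D.data.d i = D.data.d k) := by
  have hd : ∀ i, 0 < D.data.d i := fun i => by
    have : FiniteDimensional ℝ (LieAlg E G) := inferInstanceAs (FiniteDimensional ℝ E)
    exact Nat.pos_of_ne_zero fun h0 => D.ne_bot i (Submodule.finrank_eq_zero.1 h0)
  have hn : 1 < D.data.n := by
    have h1 : ∑ _i : Fin r, (1 : ℝ) ≤ D.data.n :=
      Finset.sum_le_sum fun i _ => by exact_mod_cast hd i
    have h2 : (2 : ℝ) ≤ r := by exact_mod_cast hr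
    simp at h1
    linarith
  obtain ⟨T, hT, hW, hcV⟩ := htype.exists_param hnull
  obtain ⟨hVH, hWH⟩ := htype.mem_halfWeights
  have hL : (line[ℝ, V, W] : Set (Fin r → ℝ)) ∩ D.data.polytope ⊆ segment ℝ V W := by
    intro x hx
    have hV : V ∈ segment ℝ V W := left_mem_segment ℝ V W
    have hW' : W ∈ segment ℝ V W := right_mem_segment ℝ V W
    rw [← htype.line_inter] at hV hW' ⊢
    exact ⟨affineSpan_pair_le_of_mem_of_mem hV.1 hW'.1 hx.1, hx.2⟩
  obtain ⟨hWC, heC, hT3, hJ⟩ := D.data.edge_rigidity hd hn hF hu hc hnull hT hW hcV hVH hWH hmid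
    htype.isEdge hL
  have hpos : ∀ i, (0 : ℝ) < D.data.d i := fun i => by exact_mod_cast hd i
  have hVc : V - c ≠ 0 := by
    intro h0
    rw [sub_eq_zero] at h0
    exact hcV (h0 ▸ hnull)
  refine ⟨hWC, ⟨_, heC, ?_⟩, ⟨T / (T - 1), ?_, ?_, ?_⟩, ?_, ?_, ?_⟩
  · refine ⟨?_, htype.ne.symm, ?_⟩
    · refine ⟨(T - 1) / T, ⟨by apply div_nonneg <;> linarith, by
        rw [div_le_one] <;> linarith⟩, ?_⟩
      rw [AffineMap.lineMap_apply_module]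
      rw [hW]
      have : T ≠ 0 := by linarith
      match_scalars <;> field_simp <;> ring
    · rw [hW]
      intro h0
      have : (T : ℝ) = 1 + T := smul_left_injective ℝ hVc (add_left_cancel h0)
      linarith
  · have hT' : T - 1 ≠ 0 := by linarith
    nth_rewrite 1 [hW]
    match_scalars <;> field_simp <;> ring
  · rw [one_lt_div] <;> linarith
  · rw [div_le_div_iff₀] <;> linarith
  · rintro ⟨i, j, hij, rfl, rfl⟩
    rw [D.data.J_bar_single_sub hd hn hij, D.data.J_bar_neg_single hd hn] at hJ
    have := div_pos four_pos (hpos j)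
    linarith
  · rintro ⟨i, j, hij, rfl, rfl⟩
    rw [D.data.J_bar_single_sub hd hn hij, D.data.J_bar_neg_single hd hn] at hJ
    have := div_pos four_pos (hpos j)
    linarith
  · rintro i j k hij hjk - rfl rfl
    rw [D.data.J_bar_single_sub hd hn hij.symm, D.data.J_bar_single_sub hd hn hjk] at hJ
    have h4 : 4 / (D.data.d i : ℝ) = 4 / (D.data.d k : ℝ) := by linarith
    rw [div_eq_div_iff (hpos i).ne' (hpos k).ne'] at h4
    have : (D.data.d i : ℝ) = D.data.d k := by linarith
    exact_mod_cast this
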